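/- For a permutation $\sigma$ of $\{1,\dots,k\}$ (a $k$-point permutation) and a permutation $\pi$ of $\{1,\dots,n\}$, let $d(\sigma,\pi)$ be the probability that a uniformly random $k$-element set $a_1<\dots<a_k$ of $\{1,\dots,n\}$ satisfies $\sigma(i)<\sigma(j)\iff\pi(a_i)<\pi(a_j)$ for all $i,j$ (with $d(\sigma,\pi)=0$ if $k>n$). A sequence $(\pi_n)$ of permutations whose sizes tend to infinity is quasirandom if $d(\sigma,\pi_n)\to 1/|\sigma|!$ for every permutation $\sigma$. A set $Z$ of permutations is quasirandom-forcing if every sequence $(\pi_n)$ of permutations whose sizes tend to infinity is quasirandom if and only if $d(\sigma,\pi_n)\to 1/|\sigma|!$ for every $\sigma\in Z$. The permutation matrix $A_\pi$ of a $k$-point permutation $\pi$ is the $k\times k$ matrix with entry $1$ at the positions $(i,\pi(i))$ and $0$ elsewhere. A $4$-point permutation $\pi$ is written $\pi(1)\pi(2)\pi(3)\pi(4)$. **Theorem.** (a) Let $\pi_1,\pi_2,\pi_3,\pi_4$ be $4$-point permutations such that $A_{\pi_1}+A_{\pi_2}+A_{\pi_3}+A_{\pi_4}$ is the all-ones matrix.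 If $\{\pi_1,\pi_2,\pi_3,\pi_4\}$ is neither $\{1234,2143,3412,4321\}$ nor $\{1324,2413,3142,4231\}$, then the set $\{\pi_1,\pi_2,\pi_3,\pi_4\}$ is not quasirandom-forcing. (b) For $4$-point permutations $\pi_1,\dots,\pi_4$, the matrix $A_{\pi_1}+A_{\pi_2}+A_{\pi_3}+A_{\pi_4}$ is the all-ones matrix if and only if some rotation or reflection of the $4\times4$ grid (acting on the sets of cells $\{(i,\pi(i))\}$) carries $\{\pi_1,\dots,\pi_4\}$ to one of the following twelve sets; and in that case exactly one of the twelve sets arises in this way: $\{1234,2143,3412,4321\}$, $\{1234,2143,3421,4312\}$, $\{1234,2341,3412,4123\}$, $\{1234,2413,3142,4321\}$, $\{1243,2134,3421,4312\}$, $\{1243,2314,3421,4132\}$, $\{1324,2143,3412,4231\}$, $\{1324,2413,3142,4231\}$, $\{1324,2413,3241,4132\}$, $\{1342,2431,3124,4213\}$, $\{1342,2431,3214,4123\}$, $\{1432,2341,3214,4123\}$. -/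

import Mathlib

open Filter Topology

/-- A permutation of some finite size `k`, together with its size; a `k`-point permutation is a
bijection of the `k`-element ordered set `Fin k`. -/
abbrev FinPerm : Type := Σ k : ℕ, Equiv.Perm (Fin k)

/-- The subpermutation of `π` induced by the set of positions `A` is `σ`: if `a₁ < ⋯ < aₖ` are the
elements of `A`, then `σ i < σ j` exactly when `π aᵢ < π aⱼ`. -/
def InducesPattern {n k : ℕ} (π : Equiv.Perm (Fin n)) (A : Finset (Fin n))
    (σ : Equiv.Perm (Fin k)) : Prop :=
  ∃ h : A.card = k, ∀ i j : Fin k,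
    σ i < σ j ↔ π (A.orderEmbOfFin h i) < π (A.orderEmbOfFin h j)

open Classical in
/-- The pattern density of `σ` in `π`: the proportion of the `|σ|`-element sets of positions of `π`
that induce `σ`. It is `0` if `|σ| > |π|`, since then there are no such sets. -/
noncomputable def patternDensity (σ π : FinPerm) : ℝ :=
  (((Finset.univ : Finset (Fin π.1)).powersetCard σ.1).filter
      (fun A => InducesPattern π.2 A σ.2)).card / (π.1.choose σ.1 : ℝ)

/-- A sequence of permutations is quasirandom if the sizes tend to infinity and the density of
every permutation `σ` converges to `1 / |σ|!`. -/
def IsQuasirandom (p : ℕ → FinPerm) : Prop :=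
  Tendsto (fun n => (p n).1) atTop atTop ∧
    ∀ σ : FinPerm, Tendsto (fun n => patternDensity σ (p n)) atTop (𝓝 (1 / (σ.1.factorial : ℝ)))

/-- A set `Z` of permutations is quasirandom-forcing if a sequence of permutations whose sizes tend
to infinity is quasirandom if and only if the density of each `σ ∈ Z` converges to `1 / |σ|!`. -/
def IsQuasirandomForcing (Z : Set FinPerm) : Prop :=
  ∀ p : ℕ → FinPerm, Tendsto (fun n => (p n).1) atTop atTop →
    (IsQuasirandom p ↔
      ∀ σ ∈ Z, Tendsto (fun n => patternDensity σ (p n)) atTop (𝓝 (1 / (σ.1.factorial : ℝ))))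

/-- The one-line notation `π(1) π(2) π(3) π(4)` of a `4`-point permutation, with values in
`{1, 2, 3, 4}`. -/
def oneLine (π : Equiv.Perm (Fin 4)) : Fin 4 → ℕ := fun i => (π i : ℕ) + 1

/-- The set of the one-line notations of the members of a quadruple. -/
def wordSet (π : Fin 4 → Equiv.Perm (Fin 4)) : Finset (Fin 4 → ℕ) :=
  Finset.univ.image (fun i => oneLine (π i))

/-- The eight rotations and reflections of the square, acting on permutations through the cells
`(i, π i)`: `inv` reflects in the diagonal, `flipX` reverses the positions and `flipY` reverses the
values. -/
def squareSymmetry (inv flipX flipY : Bool) {k : ℕ} (π : Equiv.Perm (Fin k)) :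
    Equiv.Perm (Fin k) :=
  (if flipY then Fin.revPerm else 1) * (if inv then π⁻¹ else π) *
    (if flipX then Fin.revPerm else 1)

/-- The twelve quadruples representing, up to symmetry, all quadruples of `4`-point permutations
whose permutation matrices sum to the all-ones matrix. -/
def latinQuadruple : Fin 12 → Finset (Fin 4 → ℕ) :=
  ![{![1, 2, 3, 4], ![2, 1, 4, 3], ![3, 4, 1, 2], ![4, 3, 2, 1]},
    {![1, 2, 3, 4], ![2, 1, 4, 3], ![3, 4, 2, 1], ![4, 3, 1, 2]},
    {![1, 2, 3, 4], ![2, 3, 4, 1], ![3, 4, 1, 2], ![4, 1, 2, 3]},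
    {![1, 2, 3, 4], ![2, 4, 1, 3], ![3, 1, 4, 2], ![4, 3, 2, 1]},
    {![1, 2, 4, 3], ![2, 1, 3, 4], ![3, 4, 2, 1], ![4, 3, 1, 2]},
    {![1, 2, 4, 3], ![2, 3, 1, 4], ![3, 4, 2, 1], ![4, 1, 3, 2]},
    {![1, 3, 2, 4], ![2, 1, 4, 3], ![3, 4, 1, 2], ![4, 2, 3, 1]},
    {![1, 3, 2, 4], ![2, 4, 1, 3], ![3, 1, 4, 2], ![4, 2, 3, 1]},
    {![1, 3, 2, 4], ![2, 4, 1, 3], ![3, 2, 4, 1], ![4, 1, 3, 2]},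
    {![1, 3, 4, 2], ![2, 4, 3, 1], ![3, 1, 2, 4], ![4, 2, 1, 3]},
    {![1, 3, 4, 2], ![2, 4, 3, 1], ![3, 2, 1, 4], ![4, 1, 2, 3]},
    {![1, 4, 3, 2], ![2, 3, 4, 1], ![3, 2, 1, 4], ![4, 1, 2, 3]}]

/-! For (a), it suffices to exhibit a sequence of permutations in which the four given patterns have
limit density `1 / 24` while some fifth pattern does not. The sequence comes from a grid: points are
spread uniformly inside finitely many cells, cell `l` receiving mass `v l`, and the permutation is
read off from the horizontal and vertical orders. Only these orders matter, so no marginal condition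
on `v` is needed. The limit density of a pattern is then a homogeneous polynomial in `v` whose
coefficients count how ties between blocks are resolved (`limitDensity`,
`exists_seq_tendsto_limitDensity`).

Prescribing four densities gives four quartic equations in six or seven weights. An exact solution
need not be written down: at a rational point where the equations hold up to a tiny error, and along
four directions that nearly invert the Jacobian, a contraction argument yields a true real solution
close by (`exists_quarticForm_eq_one`). The fifth density is too far from `1 / 24` at the rational
point for this small move to repair it. All the required inequalities are between integers and form
a finite certificate (`IsCertificate`, `IsCertificate.exists_weights`).

Rotations and reflections of a pattern can be transferred to the grid
(`exists_limitDensity_squareSymmetry`), so one certificate serves a whole orbit of quadruples. The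
two excluded quadruples are each invariant under all symmetries, which leaves ten orbits and ten
certificates.

For (b), the matrix identity says that each cell of the grid lies on exactly one of the four
permutations. Ordering them by their first value leaves a small enumeration, checked by computation.
-/

/-! ### Tuples with coincidences are rare -/

open Classical in
theorem card_tuple_apply_eq_le {P K : Type*} [Fintype P] {k : ℕ} (κ : P → K) (B : ℕ)
    (hB : ∀ c, (Finset.univ.filter fun p => κ p = c).card ≤ B) {i j : Fin k} (hij : i ≠ j) :
    (Finset.univ.filter fun s : Fin k → P => κ (s i) = κ (s j)).card * Fintype.card P ≤
      B * Fintype.card P ^ k := by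
  have h1 : (Finset.univ.filter fun s : Fin k → P => κ (s i) = κ (s j)).card ≤
      B * (Finset.univ : Finset ({l // l ≠ j} → P)).card := by
    apply Finset.card_le_mul_card_image_of_maps_to
      (f := fun (s : Fin k → P) (l : {l // l ≠ j}) => s l) (fun _ _ => Finset.mem_univ _)
    intro b _
    -- With all other coordinates fixed, `s j` is confined to the fibre of `κ` through `s i`, which
    -- has at most `B` elements.
    refine le_trans ?_ (hB (κ (b ⟨i, hij⟩)))
    apply Finset.card_le_card_of_injOn (fun s => s j)
    · intro s hs
      simp only [Finset.coe_filter, Finset.mem_filter, Finset.mem_univ, true_and,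
        Set.mem_ofPred_eq] at hs ⊢
      rw [← hs.2, hs.1]
    · intro s hs t ht hst
      simp only [Finset.coe_filter, Finset.mem_filter, Finset.mem_univ, true_and,
        Set.mem_ofPred_eq] at hs ht
      funext l
      by_cases hl : l = j
      · rw [hl]; exact hst
      · exact congrFun (hs.2.trans ht.2.symm) ⟨l, hl⟩
  have h2 : (Finset.univ : Finset ({l // l ≠ j} → P)).card * Fintype.card P =
      Fintype.card P ^ k := by
    rw [Finset.card_univ, Fintype.card_fun, ← pow_succ]
    congr 1
    have := j.pos
    simp [Fintype.card_subtype_compl]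
    omega
  calc _ ≤ B * (Finset.univ : Finset ({l // l ≠ j} → P)).card * Fintype.card P :=
        Nat.mul_le_mul_right _ h1
    _ = _ := by rw [mul_assoc, h2]

open Classical in
theorem card_not_injective_comp_le {P K : Type*} [Fintype P] {k : ℕ} (κ : P → K) (B : ℕ)
    (hB : ∀ c, (Finset.univ.filter fun p => κ p = c).card ≤ B) :
    (Finset.univ.filter fun s : Fin k → P => ¬ Function.Injective (κ ∘ s)).card *
      Fintype.card P ≤ k ^ 2 * B * Fintype.card P ^ k := by
  have h1 : (Finset.univ.filter fun s : Fin k → P => ¬ Function.Injective (κ ∘ s)) ⊆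
      ((Finset.univ : Finset (Fin k × Fin k)).filter fun q => q.1 ≠ q.2).biUnion
        fun q => Finset.univ.filter fun s : Fin k → P => κ (s q.1) = κ (s q.2) := by
    intro s hs
    simp only [Finset.mem_filter, Finset.mem_univ, true_and, Function.Injective,
      not_forall] at hs
    obtain ⟨a, b, h, hab⟩ := hs
    simp only [Finset.mem_biUnion, Finset.mem_filter, Finset.mem_univ, true_and]
    exact ⟨(a, b), hab, h⟩
  calc _ ≤ (∑ q ∈ (Finset.univ : Finset (Fin k × Fin k)).filter fun q => q.1 ≠ q.2,
        (Finset.univ.filter fun s : Fin k → P => κ (s q.1) = κ (s q.2)).card) *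
          Fintype.card P :=
        Nat.mul_le_mul_right _ ((Finset.card_le_card h1).trans Finset.card_biUnion_le)
    _ ≤ ∑ q ∈ (Finset.univ : Finset (Fin k × Fin k)).filter fun q => q.1 ≠ q.2,
        B * Fintype.card P ^ k := by
        rw [Finset.sum_mul]
        apply Finset.sum_le_sum
        intro q hq
        exact card_tuple_apply_eq_le κ B hB (Finset.mem_filter.1 hq).2
    _ ≤ ∑ q : Fin k × Fin k, B * Fintype.card P ^ k :=
        Finset.sum_le_sum_of_subset (Finset.filter_subset _ _)
    _ = _ := by simp [sq, mul_assoc]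

/-! ### Probability that random points in given blocks are increasing -/

/-- The key of a point for the lexicographic order on block and position inside the block. -/
def lexKey {k N : ℕ} (f : Fin k → ℤ) (x : Fin k → Fin N) : Fin k → ℤ ×ₗ Fin N :=
  fun i => toLex (f i, x i)

open Classical in
/-- The number of ways to choose positions inside the blocks `f` so that the resulting points
are strictly increasing. -/
noncomputable def increasingCount {k : ℕ} (N : ℕ) (f : Fin k → ℤ) : ℕ :=
  (Finset.univ.filter fun x : Fin k → Fin N => StrictMono (lexKey f x)).card

open Classical in
/-- The asymptotic probability that uniformly random positions inside the blocks `f` give an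
increasing sequence of points. -/
noncomputable def blockCoeff {k : ℕ} (f : Fin k → ℤ) : ℝ :=
  if Monotone f then
    ((Finset.univ.filter fun τ : Equiv.Perm (Fin k) => f ∘ τ = f).card : ℝ)⁻¹ else 0

theorem monotone_of_strictMono_lexKey {k N : ℕ} {f : Fin k → ℤ} {x : Fin k → Fin N}
    (h : StrictMono (lexKey f x)) : Monotone f := by
  intro i j hij
  have := h.monotone hij
  simp only [lexKey, Prod.Lex.toLex_le_toLex] at this
  rcases this with h | h
  · exact h.le
  · exact h.1.le

/-- The permutation is the sorting permutation of the keys; it can only move points within a block.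
This is why the probability in `blockCoeff` is the inverse of the order of the stabilizer of `f`. -/
theorem existsUnique_strictMono_lexKey {k N : ℕ} {f : Fin k → ℤ} (hf : Monotone f)
    {x : Fin k → Fin N} (hx : Function.Injective x) :
    ∃! τ : Equiv.Perm (Fin k), f ∘ τ = f ∧ StrictMono (lexKey f (x ∘ τ)) := by
  have hinj : Function.Injective (lexKey f x) := by
    intro i j h
    have := congrArg (fun z => (ofLex z).2) h
    exact hx this
  have hcomp : ∀ τ : Equiv.Perm (Fin k), f ∘ τ = f →
      lexKey f (x ∘ τ) = lexKey f x ∘ τ := by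
    intro τ hτ
    funext i
    have := congrFun hτ i
    simp only [Function.comp_apply] at this
    simp [lexKey, this]
  have hmono := Tuple.monotone_sort (lexKey f x)
  have hst : StrictMono (lexKey f x ∘ Tuple.sort (lexKey f x)) :=
    hmono.strictMono_of_injective (hinj.comp (Equiv.injective _))
  -- Both `f` and its sorted rearrangement are monotone with the same multiset of values, so they
  -- coincide.
  have hfix : f ∘ Tuple.sort (lexKey f x) = f := by
    have h1 : Monotone (f ∘ Tuple.sort (lexKey f x)) :=
      monotone_of_strictMono_lexKey (x := x ∘ Tuple.sort (lexKey f x)) hst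
    have := Tuple.unique_monotone (f := f) (σ := Tuple.sort (lexKey f x)) (τ := 1) h1
      (by simpa using hf)
    simpa using this
  refine ⟨Tuple.sort (lexKey f x), ⟨hfix, by rw [hcomp _ hfix]; exact hst⟩, ?_⟩
  rintro τ ⟨h1, h2⟩
  rw [hcomp _ h1] at h2
  have := Tuple.unique_monotone h2.monotone hst.monotone
  ext i
  exact congrArg _ (hinj (congrFun this i))

-- Double counting of the pairs `(τ, x)` with `x ∘ τ` increasing: each `τ` contributes equally, and
-- each injective `x` has exactly one `τ`.
open Classical in
theorem stabilizer_card_mul_increasingCount {k N : ℕ} {f : Fin k → ℤ} (hf : Monotone f) :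
    (Finset.univ.filter fun τ : Equiv.Perm (Fin k) => f ∘ τ = f).card *
      (Finset.univ.filter fun x : Fin k → Fin N =>
        Function.Injective x ∧ StrictMono (lexKey f x)).card =
    (Finset.univ.filter fun x : Fin k → Fin N => Function.Injective x).card := by
  have h := Finset.sum_card_bipartiteAbove_eq_sum_card_bipartiteBelow
    (s := Finset.univ.filter fun τ : Equiv.Perm (Fin k) => f ∘ τ = f)
    (t := Finset.univ.filter fun x : Fin k → Fin N => Function.Injective x)
    (fun (τ : Equiv.Perm (Fin k)) (x : Fin k → Fin N) => StrictMono (lexKey f (x ∘ τ)))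
  have h1 : ∀ τ ∈ Finset.univ.filter fun τ : Equiv.Perm (Fin k) => f ∘ τ = f,
      (Finset.bipartiteAbove (fun (τ : Equiv.Perm (Fin k)) (x : Fin k → Fin N) =>
        StrictMono (lexKey f (x ∘ τ)))
        (Finset.univ.filter fun x : Fin k → Fin N => Function.Injective x) τ).card =
      (Finset.univ.filter fun x : Fin k → Fin N =>
        Function.Injective x ∧ StrictMono (lexKey f x)).card := by
    intro τ _
    apply Finset.card_bij' (fun x _ => x ∘ τ) (fun x _ => x ∘ τ.symm)
    · intro x hx
      simp only [Finset.mem_bipartiteAbove, Finset.mem_filter, Finset.mem_univ, true_and] at hx ⊢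
      exact ⟨hx.1.comp τ.injective, hx.2⟩
    · intro x hx
      simp only [Finset.mem_bipartiteAbove, Finset.mem_filter, Finset.mem_univ, true_and] at hx ⊢
      refine ⟨hx.1.comp τ.symm.injective, ?_⟩
      convert hx.2 using 2
      funext i; simp
    · intro x _; funext i; simp
    · intro x _; funext i; simp
  have h2 : ∀ x ∈ Finset.univ.filter fun x : Fin k → Fin N => Function.Injective x,
      (Finset.bipartiteBelow (fun (τ : Equiv.Perm (Fin k)) (x : Fin k → Fin N) =>
        StrictMono (lexKey f (x ∘ τ)))
        (Finset.univ.filter fun τ : Equiv.Perm (Fin k) => f ∘ τ = f) x).card = 1 := by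
    intro x hx
    obtain ⟨τ, h1, h2⟩ := existsUnique_strictMono_lexKey hf (Finset.mem_filter.1 hx).2
    rw [Finset.card_eq_one]
    refine ⟨τ, ?_⟩
    ext ρ
    simp only [Finset.mem_bipartiteBelow, Finset.mem_filter, Finset.mem_univ, true_and,
      Finset.mem_singleton]
    exact ⟨fun h => h2 ρ h, fun h => h ▸ h1⟩
  rw [Finset.sum_congr rfl h1, Finset.sum_congr rfl h2] at h
  simpa using h

/-- On injective tuples the count is exact by the stabilizer identity; the non-injective ones form a
fraction at most `k ^ 2 / N`. -/
theorem tendsto_increasingCount {k : ℕ} (f : Fin k → ℤ) :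
    Tendsto (fun N : ℕ => (increasingCount N f : ℝ) / (N : ℝ) ^ k) atTop (𝓝 (blockCoeff f)) := by
  classical
  by_cases hf : Monotone f
  swap
  · have h0 : ∀ N, increasingCount N f = 0 := by
      intro N
      rw [increasingCount, Finset.card_eq_zero, Finset.filter_eq_empty_iff]
      exact fun x _ h => hf (monotone_of_strictMono_lexKey h)
    simp [h0, blockCoeff, hf]
  set H := (Finset.univ.filter fun τ : Equiv.Perm (Fin k) => f ∘ τ = f).card with hH
  have hHpos : (0 : ℝ) < H := by
    rw [Nat.cast_pos, hH, Finset.card_pos]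
    exact ⟨1, by simp⟩
  set bad : ℕ → ℕ := fun N =>
    (Finset.univ.filter fun x : Fin k → Fin N => ¬ Function.Injective x).card with hbad
  set good : ℕ → ℕ := fun N => (Finset.univ.filter fun x : Fin k → Fin N =>
        Function.Injective x ∧ StrictMono (lexKey f x)).card with hgood
  have hsum : ∀ N, (H * good N : ℝ) + bad N = (N : ℝ) ^ k := by
    intro N
    have h1 := stabilizer_card_mul_increasingCount (N := N) hf
    have h2 := Finset.card_filter_add_card_filter_not (s := Finset.univ)
      (fun x : Fin k → Fin N => Function.Injective x)
    rw [← h1] at h2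
    simp only [Finset.card_univ, Fintype.card_fun, Fintype.card_fin] at h2
    exact_mod_cast h2
  have hbadle : ∀ N, (bad N : ℝ) * N ≤ k ^ 2 * (N : ℝ) ^ k := by
    intro N
    have h1 := card_not_injective_comp_le (k := k) (id : Fin N → Fin N) 1 (by
      intro c
      rw [Finset.card_le_one]
      simp)
    simp only [Fintype.card_fin, mul_one, Function.id_comp] at h1
    exact_mod_cast h1
  have hlim : Tendsto (fun N : ℕ => (bad N : ℝ) / (N : ℝ) ^ k) atTop (𝓝 0) := by
    apply squeeze_zero' (g := fun N : ℕ => (k : ℝ) ^ 2 / N)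
    · filter_upwards with N; positivity
    · filter_upwards [eventually_gt_atTop 0] with N hN
      have hN' : (0 : ℝ) < N := by exact_mod_cast hN
      rw [div_le_div_iff₀ (by positivity) hN']
      exact hbadle N
    · exact tendsto_const_div_atTop_nhds_zero_nat _
  have hcount : ∀ N, good N ≤ increasingCount N f ∧ increasingCount N f ≤ good N + bad N := by
    intro N
    constructor
    · apply Finset.card_le_card
      intro x hx
      simp only [Finset.mem_filter, Finset.mem_univ, true_and] at hx ⊢
      exact hx.2
    · refine le_trans (Finset.card_le_card ?_) (Finset.card_union_le _ _)
      intro x hx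
      simp only [Finset.mem_filter, Finset.mem_univ, true_and, Finset.mem_union] at hx ⊢
      tauto
  have hgoodlim : Tendsto (fun N : ℕ => (good N : ℝ) / (N : ℝ) ^ k) atTop (𝓝 (H : ℝ)⁻¹) := by
    have h1 : Tendsto (fun N : ℕ => (H : ℝ)⁻¹ * (1 - (bad N : ℝ) / (N : ℝ) ^ k)) atTop
        (𝓝 ((H : ℝ)⁻¹ * (1 - 0))) := (tendsto_const_nhds.sub hlim).const_mul _
    rw [sub_zero, mul_one] at h1
    apply h1.congr'
    filter_upwards [eventually_gt_atTop 0] with N hN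
    have hN' : (0 : ℝ) < (N : ℝ) ^ k := by positivity
    have := hsum N
    field_simp
    linarith
  have hb : blockCoeff f = (H : ℝ)⁻¹ := by
    rw [blockCoeff, if_pos hf]
  rw [hb]
  have hup := hgoodlim.add hlim
  rw [add_zero] at hup
  apply tendsto_of_tendsto_of_tendsto_of_le_of_le hgoodlim hup
  · intro N
    have := (hcount N).1
    simp only
    gcongr
  · intro N
    have h2 : ((increasingCount N f : ℕ) : ℝ) ≤ good N + bad N := by exact_mod_cast (hcount N).2
    simp only
    rw [← add_div]
    gcongr

/-! ### From planar point sets to permutations -/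

theorem exists_equiv_fin_lt_iff {P α : Type*} [Fintype P] [LinearOrder α] (X : P → α)
    (hX : Function.Injective X) :
    ∃ e : P ≃ Fin (Fintype.card P), ∀ p q, e p < e q ↔ X p < X q := by
  let _ : LinearOrder P := LinearOrder.lift' X hX
  exact ⟨(Fintype.orderIsoFinOfCardEq P rfl).symm.toEquiv, fun p q =>
    (Fintype.orderIsoFinOfCardEq P rfl).symm.lt_iff_lt⟩

theorem forall_lt_iff_lt_iff_strictMono {α : Type*} [LinearOrder α] {k : ℕ}
    (σ : Equiv.Perm (Fin k)) (y : Fin k → α) :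
    (∀ i j, σ i < σ j ↔ y i < y j) ↔ StrictMono (y ∘ σ.symm) := by
  constructor
  · intro h i j hij
    have := (h (σ.symm i) (σ.symm j)).1 (by simpa using hij)
    exact this
  · intro h i j
    have := h.lt_iff_lt (a := σ i) (b := σ j)
    simpa using this.symm

open Classical in
theorem card_inducesPattern {n k : ℕ} (π : Equiv.Perm (Fin n)) (σ : Equiv.Perm (Fin k)) :
    (((Finset.univ : Finset (Fin n)).powersetCard k).filter
      (fun A => InducesPattern π A σ)).card =
    (Finset.univ.filter fun t : Fin k → Fin n =>
      StrictMono t ∧ StrictMono (π ∘ t ∘ σ.symm)).card := by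
  symm
  apply Finset.card_bij (fun t _ => Finset.univ.image t)
  · intro t ht
    simp only [Finset.mem_filter, Finset.mem_univ, true_and] at ht
    have hcard : (Finset.univ.image t).card = k := by
      rw [Finset.card_image_of_injective _ ht.1.injective]; simp
    rw [Finset.mem_filter, Finset.mem_powersetCard]
    refine ⟨⟨Finset.subset_univ _, hcard⟩, hcard, ?_⟩
    have : t = (Finset.univ.image t).orderEmbOfFin hcard :=
      Finset.orderEmbOfFin_unique hcard (fun i => Finset.mem_image_of_mem _ (Finset.mem_univ i))
        ht.1
    rw [← this]
    exact (forall_lt_iff_lt_iff_strictMono σ (π ∘ t)).2 ht.2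
  · intro t ht u hu h
    simp only [Finset.mem_filter, Finset.mem_univ, true_and] at ht hu
    have hcard : (Finset.univ.image t).card = k := by
      rw [Finset.card_image_of_injective _ ht.1.injective]; simp
    have h1 := Finset.orderEmbOfFin_unique hcard
      (f := t) (fun i => Finset.mem_image_of_mem t (Finset.mem_univ i)) ht.1
    have h2 := Finset.orderEmbOfFin_unique hcard
      (fun i => by rw [h]; exact Finset.mem_image_of_mem u (Finset.mem_univ i)) hu.1
    exact h1.trans h2.symm
  · intro A hA
    rw [Finset.mem_filter, Finset.mem_powersetCard] at hA
    obtain ⟨⟨-, -⟩, hc, h⟩ := hA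
    refine ⟨A.orderEmbOfFin hc, ?_, ?_⟩
    · simp only [Finset.mem_filter, Finset.mem_univ, true_and]
      exact ⟨(A.orderEmbOfFin hc).strictMono,
        (forall_lt_iff_lt_iff_strictMono σ (π ∘ A.orderEmbOfFin hc)).1 h⟩
    · exact Finset.image_orderEmbOfFin_univ A hc

-- Ranking the points by `X` and by `Y` turns the point set into the permutation sending `X`-rank to
-- `Y`-rank; occurrences of a pattern become tuples increasing in `X` and, when read in the order of
-- their values, in `Y`.
open Classical in
theorem exists_perm_card_inducesPattern {P α β : Type*} [Fintype P] [LinearOrder α]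
    [LinearOrder β] (X : P → α) (Y : P → β) (hX : Function.Injective X)
    (hY : Function.Injective Y) :
    ∃ π : Equiv.Perm (Fin (Fintype.card P)), ∀ (k : ℕ) (σ : Equiv.Perm (Fin k)),
      (((Finset.univ : Finset (Fin (Fintype.card P))).powersetCard k).filter
        (fun A => InducesPattern π A σ)).card =
      (Finset.univ.filter fun s : Fin k → P =>
        StrictMono (X ∘ s) ∧ StrictMono (Y ∘ s ∘ σ.symm)).card := by
  obtain ⟨eX, hX'⟩ := exists_equiv_fin_lt_iff X hX
  obtain ⟨eY, hY'⟩ := exists_equiv_fin_lt_iff Y hY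
  refine ⟨eX.symm.trans eY, fun k σ => ?_⟩
  rw [card_inducesPattern]
  apply Finset.card_bij' (fun t _ => eX.symm ∘ t) (fun s _ => eX ∘ s)
  · intro t ht
    simp only [Finset.mem_filter, Finset.mem_univ, true_and] at ht ⊢
    refine ⟨fun i j hij => (hX' _ _).1 ?_, fun i j hij => (hY' _ _).1 ?_⟩
    · simpa using ht.1 hij
    · simpa using ht.2 hij
  · intro s hs
    simp only [Finset.mem_filter, Finset.mem_univ, true_and] at hs ⊢
    refine ⟨fun i j hij => (hX' _ _).2 (hs.1 hij), fun i j hij => ?_⟩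
    simpa using (hY' _ _).2 (hs.2 hij)
  · intro t _; funext i; simp
  · intro s _; funext i; simp

theorem strictMono_toLex_of_strictMono {α β : Type*} [LinearOrder α] [LinearOrder β] {k : ℕ}
    {f : Fin k → α} (g : Fin k → β) (h : StrictMono f) :
    StrictMono fun i => toLex (f i, g i) := by
  intro i j hij
  simp only [Prod.Lex.toLex_lt_toLex]
  exact Or.inl (h hij)

theorem strictMono_of_strictMono_toLex {α β : Type*} [LinearOrder α] [LinearOrder β] {k : ℕ}
    {f : Fin k → α} {g : Fin k → β} (hf : Function.Injective f)
    (h : StrictMono fun i => toLex (f i, g i)) : StrictMono f := by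
  intro i j hij
  have := h hij
  simp only [Prod.Lex.toLex_lt_toLex] at this
  rcases this with h | h
  · exact h
  · exact absurd (hf h.1) hij.ne

open Classical in
theorem exists_finset_injective_comp {P α : Type*} [Fintype P] [LinearOrder α] (X : P → α)
    (B : ℕ) (hB : ∀ c, (Finset.univ.filter fun p => X p = c).card ≤ B) (k : ℕ) :
    ∃ b : Finset (Fin k → P), b.card * Fintype.card P ≤ k ^ 2 * B * Fintype.card P ^ k ∧
      ∀ s ∉ b, Function.Injective (X ∘ s) :=
  ⟨_, card_not_injective_comp_le (k := k) X B fun c => by convert hB c, fun s hs => by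
    simpa using hs⟩

open Classical in
theorem exists_perm_card_inducesPattern_bounds {P α : Type*} [Fintype P] [LinearOrder α]
    (X Y : P → α) (B : ℕ)
    (hXB : ∀ c, (Finset.univ.filter fun p => X p = c).card ≤ B)
    (hYB : ∀ c, (Finset.univ.filter fun p => Y p = c).card ≤ B) :
    ∃ π : Equiv.Perm (Fin (Fintype.card P)), ∀ (k : ℕ) (σ : Equiv.Perm (Fin k)), ∃ e : ℕ,
      e * Fintype.card P ≤ 2 * (k ^ 2 * B * Fintype.card P ^ k) ∧
      (Finset.univ.filter fun s : Fin k → P =>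
        StrictMono (X ∘ s) ∧ StrictMono (Y ∘ s ∘ σ.symm)).card ≤
      (((Finset.univ : Finset (Fin (Fintype.card P))).powersetCard k).filter
        (fun A => InducesPattern π A σ)).card ∧
      (((Finset.univ : Finset (Fin (Fintype.card P))).powersetCard k).filter
        (fun A => InducesPattern π A σ)).card ≤
      (Finset.univ.filter fun s : Fin k → P =>
        StrictMono (X ∘ s) ∧ StrictMono (Y ∘ s ∘ σ.symm)).card + e := by
  -- An arbitrary numbering of the points breaks ties in both coordinates. It affects only tuples
  -- having a tie, which the sets `bX` and `bY` below contain.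
  have eP := Fintype.equivFin P
  have hinj : ∀ Z : P → α, Function.Injective fun p => toLex (Z p, eP p) := by
    intro Z p q h
    exact eP.injective (congrArg (fun z => (ofLex z).2) h)
  obtain ⟨π, hπ⟩ := exists_perm_card_inducesPattern _ _ (hinj X) (hinj Y)
  refine ⟨π, fun k σ => ?_⟩
  obtain ⟨bX, hbX, hbX'⟩ := exists_finset_injective_comp X B hXB k
  obtain ⟨bY, hbY, hbY'⟩ := exists_finset_injective_comp Y B hYB k
  refine ⟨bX.card + bY.card, by linarith, ?_, ?_⟩
  · rw [hπ]
    apply Finset.card_le_card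
    intro s hs
    simp only [Finset.mem_filter, Finset.mem_univ, true_and] at hs ⊢
    exact ⟨strictMono_toLex_of_strictMono _ hs.1, strictMono_toLex_of_strictMono _ hs.2⟩
  · rw [hπ, ← add_assoc]
    refine le_trans (Finset.card_le_card ?_) ((Finset.card_union_le _ _).trans
      (Nat.add_le_add_right (Finset.card_union_le _ _) _))
    intro s hs
    simp only [Finset.mem_filter, Finset.mem_univ, true_and, Finset.mem_union] at hs ⊢
    by_cases h1 : s ∈ bX
    · exact Or.inl (Or.inr h1)
    · by_cases h2 : s ∈ bY
      · exact Or.inr h2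
      · refine Or.inl (Or.inl ⟨strictMono_of_strictMono_toLex (hbX' s h1) hs.1,
          strictMono_of_strictMono_toLex ?_ hs.2⟩)
        exact (hbY' s h2).comp σ.symm.injective

/-! ### Pattern densities of grid constructions -/

/-- The `N ^ 2` grid points of each of the `M l` layers of each cell `l`. -/
abbrev GridPoint {L : Type*} (M : L → ℕ) (N : ℕ) : Type _ :=
  (Σ l : L, Fin (M l)) × Fin N × Fin N

theorem card_gridPoint {L : Type*} [Fintype L] (M : L → ℕ) (N : ℕ) :
    Fintype.card (GridPoint M N) = (∑ l, M l) * (N * N) := by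
  simp [GridPoint]

-- The cell, the layer and the two offsets of a point are chosen independently, and each of the two
-- order conditions involves only the offsets in its own direction. Vertical offsets are reindexed
-- by `σ.symm` so that they are listed in order of value.
open Classical in
theorem card_gridPoint_strictMono {L : Type*} [Fintype L] (M : L → ℕ) (N : ℕ) {k : ℕ}
    (col row : L → ℤ) (σ : Equiv.Perm (Fin k)) :
    (Finset.univ.filter fun s : Fin k → GridPoint M N =>
      StrictMono ((fun p : GridPoint M N => toLex (col p.1.1, p.2.1)) ∘ s) ∧
      StrictMono ((fun p : GridPoint M N => toLex (row p.1.1, p.2.2)) ∘ s ∘ σ.symm)).card =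
    ∑ l : Fin k → L, (∏ i, M (l i)) *
      (increasingCount N (col ∘ l) * increasingCount N (row ∘ l ∘ σ.symm)) := by
  let e : {s : Fin k → GridPoint M N //
      StrictMono ((fun p : GridPoint M N => toLex (col p.1.1, p.2.1)) ∘ s) ∧
      StrictMono ((fun p : GridPoint M N => toLex (row p.1.1, p.2.2)) ∘ s ∘ σ.symm)} ≃
      (Σ l : Fin k → L, (∀ i, Fin (M (l i))) ×
        {x : Fin k → Fin N // StrictMono (lexKey (col ∘ l) x)} ×
        {y : Fin k → Fin N // StrictMono (lexKey (row ∘ l ∘ σ.symm) y)}) :=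
    { toFun := fun s => ⟨fun i => (s.1 i).1.1, fun i => (s.1 i).1.2,
        ⟨fun i => (s.1 i).2.1, s.2.1⟩, ⟨fun i => (s.1 (σ.symm i)).2.2, s.2.2⟩⟩
      invFun := fun q => ⟨fun i => (⟨q.1 i, q.2.1 i⟩, q.2.2.1.1 i, q.2.2.2.1 (σ i)),
        q.2.2.1.2, by
          convert q.2.2.2.2 using 1
          funext i
          simp [lexKey]⟩
      left_inv := fun s => by simp
      right_inv := fun q => by simp }
  rw [← Fintype.card_subtype, Fintype.card_congr e, Fintype.card_sigma]
  apply Finset.sum_congr rfl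
  intro l _
  rw [Fintype.card_prod, Fintype.card_prod, Fintype.card_pi, increasingCount, increasingCount,
    Fintype.card_subtype, Fintype.card_subtype]
  simp

/-- The limit density of a pattern in large permutations whose points are spread uniformly in the
cells `(col l, row l)` of a grid, with weight `v l`. -/
noncomputable def limitDensity {L : Type*} [Fintype L] {k : ℕ} (col row : L → ℤ) (v : L → ℝ)
    (σ : Equiv.Perm (Fin k)) : ℝ :=
  k.factorial * ∑ s : Fin k → L,
    (∏ i, v (s i)) * (blockCoeff (col ∘ s) * blockCoeff (row ∘ s ∘ σ.symm))

theorem tendsto_pow_div_choose (k : ℕ) :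
    Tendsto (fun n : ℕ => (n : ℝ) ^ k / (n.choose k : ℝ)) atTop (𝓝 (k.factorial : ℝ)) := by
  have h := isEquivalent_choose k
  have h1 := (Asymptotics.isEquivalent_iff_tendsto_one (by
    filter_upwards [eventually_gt_atTop 0] with n hn
    have : (0 : ℝ) < n := by exact_mod_cast hn
    positivity)).1 h
  have h2 := (h1.inv₀ one_ne_zero).const_mul (k.factorial : ℝ)
  rw [inv_one, mul_one] at h2
  apply h2.congr
  intro n
  have : (k.factorial : ℝ) ≠ 0 := by positivity
  simp only [Pi.div_apply, inv_div]
  field_simp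

open Classical in
theorem card_gridPoint_fiber_le {L : Type*} [Fintype L] (M : L → ℕ) (N : ℕ)
    (key : L → ℤ) (coord : Fin N × Fin N → Fin N) (rest : Fin N × Fin N → Fin N)
    (h : Function.Injective fun z => (coord z, rest z)) (c : ℤ ×ₗ Fin N) :
    (Finset.univ.filter fun p : GridPoint M N =>
      toLex (key p.1.1, coord p.2) = c).card ≤ (∑ l, M l) * N := by
  have hc : (Finset.univ : Finset ((Σ l : L, Fin (M l)) × Fin N)).card = (∑ l, M l) * N := by
    simp
  rw [← hc]
  apply Finset.card_le_card_of_injOn (fun p => (p.1, rest p.2)) (fun _ _ => by simp)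
  intro p hp q hq hpq
  simp only [Finset.coe_filter, Finset.mem_univ, true_and, Set.mem_ofPred_eq] at hp hq
  have h1 : coord p.2 = coord q.2 := congrArg (fun z => (ofLex z).2) (hp.trans hq.symm)
  simp only [Prod.mk.injEq] at hpq
  exact Prod.ext hpq.1 (h (Prod.ext h1 hpq.2))

/-- The construction has `S N * N ^ 2` points, at most `S N * N` of which share a key in either
direction, so tuples with ties are negligible. The remaining count factors, and each factor
converges. -/
theorem exists_seq_tendsto_limitDensity {L : Type*} [Fintype L] (col row : L → ℤ) (v : L → ℝ)
    (hv : ∀ l, 0 ≤ v l) (hv1 : ∑ l, v l = 1) :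
    ∃ p : ℕ → FinPerm, Tendsto (fun n => (p n).1) atTop atTop ∧
      ∀ (k : ℕ) (σ : Equiv.Perm (Fin k)),
        Tendsto (fun n => patternDensity ⟨k, σ⟩ (p n)) atTop (𝓝 (limitDensity col row v σ)) := by
  classical
  -- Masses are realized by numbers of layers; the `+ 1` keeps the total `S N` positive and vanishes
  -- in the limit.
  set M : ℕ → L → ℕ := fun N l => ⌊v l * N⌋₊ + 1 with hM
  set S : ℕ → ℕ := fun N => ∑ l, M N l with hS
  have hL : Nonempty L := by
    by_contra h
    rw [not_nonempty_iff] at h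
    simp at hv1
  have hSpos : ∀ N, 1 ≤ S N := by
    intro N
    obtain ⟨l⟩ := hL
    exact le_trans (by simp [hM]) (Finset.single_le_sum (f := M N) (fun _ _ => Nat.zero_le _)
      (Finset.mem_univ l))
  have hMlim : ∀ l, Tendsto (fun N : ℕ => (M N l : ℝ) / N) atTop (𝓝 (v l)) := by
    intro l
    have h1 := (tendsto_nat_floor_mul_div_atTop (hv l)).comp
      (tendsto_natCast_atTop_atTop (R := ℝ))
    have h2 := h1.add (tendsto_const_div_atTop_nhds_zero_nat (1 : ℝ))
    rw [add_zero] at h2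
    apply h2.congr
    intro N
    simp [hM, add_div]
  have hSlim : Tendsto (fun N : ℕ => (S N : ℝ) / N) atTop (𝓝 1) := by
    rw [← hv1]
    have := tendsto_finsetSum Finset.univ fun l (_ : l ∈ Finset.univ) => hMlim l
    apply this.congr
    intro N
    simp [hS, Finset.sum_div]
  have hfrac : ∀ l, Tendsto (fun N : ℕ => (M N l : ℝ) / S N) atTop (𝓝 (v l)) := by
    intro l
    have := (hMlim l).div hSlim one_ne_zero
    rw [div_one] at this
    apply this.congr'
    filter_upwards [eventually_gt_atTop 0] with N hN
    have h1 : (N : ℝ) ≠ 0 := by positivity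
    have h2 : (S N : ℝ) ≠ 0 := by have := hSpos N; positivity
    simp only [Pi.div_apply]
    field_simp
  have hex := fun N => exists_perm_card_inducesPattern_bounds (P := GridPoint (M N) N)
    (fun p => toLex (col p.1.1, p.2.1)) (fun p => toLex (row p.1.1, p.2.2)) (S N * N)
    (fun c => by
      convert card_gridPoint_fiber_le (M N) N col (fun z => z.1) (fun z => z.2)
        (fun _ _ h => h) c)
    (fun c => by
      convert card_gridPoint_fiber_le (M N) N row (fun z => z.2) (fun z => z.1)
        (fun _ _ h => by simpa [Prod.ext_iff, and_comm] using h) c)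
  choose π e he hlow hup using hex
  have hn : ∀ N, Fintype.card (GridPoint (M N) N) = S N * (N * N) :=
    fun N => card_gridPoint (M N) N
  have hsize : Tendsto (fun N => Fintype.card (GridPoint (M N) N)) atTop atTop := by
    apply tendsto_atTop_mono (f := fun N : ℕ => N) _ tendsto_id
    intro N
    rw [hn]
    rcases Nat.eq_zero_or_pos N with h | h
    · simp [h]
    · nlinarith [hSpos N, Nat.mul_le_mul (hSpos N) (Nat.mul_le_mul h le_rfl : 1 * N ≤ N * N)]
  refine ⟨fun N => ⟨Fintype.card (GridPoint (M N) N), π N⟩, hsize, fun k σ => ?_⟩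
  set occ : ℕ → ℕ := fun N =>
    (((Finset.univ : Finset (Fin (Fintype.card (GridPoint (M N) N)))).powersetCard k).filter
        (fun A => InducesPattern (π N) A σ)).card with hocc
  set gen : ℕ → ℕ := fun N => ∑ l : Fin k → L, (∏ i, M N (l i)) *
      (increasingCount N (col ∘ l) * increasingCount N (row ∘ l ∘ σ.symm)) with hgen
  have hlow' : ∀ N, gen N ≤ occ N := by
    intro N
    have := hlow N k σ
    rwa [card_gridPoint_strictMono] at this
  have hup' : ∀ N, occ N ≤ gen N + e N k σ := by
    intro N
    have := hup N k σ
    rwa [card_gridPoint_strictMono] at this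
  set n : ℕ → ℕ := fun N => Fintype.card (GridPoint (M N) N) with hndef
  have hnN : ∀ N, (n N : ℝ) = S N * (N * N) := by intro N; rw [hndef]; exact_mod_cast hn N
  have hgenlim : Tendsto (fun N => (gen N : ℝ) / (n N : ℝ) ^ k) atTop
      (𝓝 (∑ s : Fin k → L,
        (∏ i, v (s i)) * (blockCoeff (col ∘ s) * blockCoeff (row ∘ s ∘ σ.symm)))) := by
    have h1 : Tendsto (fun N : ℕ => ∑ s : Fin k → L, (∏ i, ((M N (s i) : ℝ) / S N)) *
        (((increasingCount N (col ∘ s) : ℝ) / (N : ℝ) ^ k) *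
          ((increasingCount N (row ∘ s ∘ σ.symm) : ℝ) / (N : ℝ) ^ k))) atTop
        (𝓝 (∑ s : Fin k → L,
          (∏ i, v (s i)) * (blockCoeff (col ∘ s) * blockCoeff (row ∘ s ∘ σ.symm)))) := by
      apply tendsto_finsetSum
      intro s _
      exact (tendsto_finsetProd _ fun i _ => hfrac (s i)).mul
        ((tendsto_increasingCount _).mul (tendsto_increasingCount _))
    apply h1.congr'
    filter_upwards [eventually_gt_atTop 0] with N hN
    have hN' : (N : ℝ) ≠ 0 := by positivity
    have hS' : (S N : ℝ) ≠ 0 := by have := hSpos N; positivity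
    rw [hnN, hgen]
    push_cast
    rw [Finset.sum_div]
    apply Finset.sum_congr rfl
    intro s _
    rw [Finset.prod_div_distrib]
    simp only [Finset.prod_const, Finset.card_univ, Fintype.card_fin, mul_pow]
    field_simp
  have helim : Tendsto (fun N => (e N k σ : ℝ) / (n N : ℝ) ^ k) atTop (𝓝 0) := by
    apply squeeze_zero' (g := fun N : ℕ => (2 * k ^ 2 : ℝ) / N)
    · filter_upwards with N; positivity
    · filter_upwards [eventually_gt_atTop 0] with N hN
      have hN' : (0 : ℝ) < N := by positivity
      have hS' : (0 : ℝ) < S N := by have := hSpos N; positivity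
      have hnpos : (0 : ℝ) < n N := by rw [hnN]; positivity
      rw [div_le_div_iff₀ (by positivity) hN']
      have h1 : (e N k σ : ℝ) * n N ≤ 2 * (k ^ 2 * (S N * N) * (n N : ℝ) ^ k) := by
        exact_mod_cast he N k σ
      have h2 : (e N k σ : ℝ) * N * (S N * N) ≤ 2 * k ^ 2 * (n N : ℝ) ^ k * (S N * N) := by
        rw [hnN] at h1 ⊢
        linarith
      exact le_of_mul_le_mul_right h2 (by positivity)
    · exact tendsto_const_div_atTop_nhds_zero_nat _
  have hocclim : Tendsto (fun N => (occ N : ℝ) / (n N : ℝ) ^ k) atTop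
      (𝓝 (∑ s : Fin k → L,
        (∏ i, v (s i)) * (blockCoeff (col ∘ s) * blockCoeff (row ∘ s ∘ σ.symm)))) := by
    have h2 := hgenlim.add helim
    rw [add_zero] at h2
    apply tendsto_of_tendsto_of_tendsto_of_le_of_le hgenlim h2
    · intro N
      have := hlow' N
      simp only
      gcongr
    · intro N
      have h3 : ((occ N : ℕ) : ℝ) ≤ gen N + e N k σ := by exact_mod_cast hup' N
      simp only
      rw [← add_div]
      gcongr
  -- Passing from normalization by `n ^ k` to normalization by `n.choose k` produces the factor `k!`
  -- of `limitDensity`.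
  have hfinal := ((tendsto_pow_div_choose k).comp hsize).mul hocclim
  rw [limitDensity]
  apply hfinal.congr'
  filter_upwards [eventually_gt_atTop 0] with N hN
  have hS' : (0 : ℝ) < S N := by have := hSpos N; positivity
  have hnpos : (n N : ℝ) ≠ 0 := by rw [hnN]; positivity
  simp only [Function.comp_apply, patternDensity]
  rw [mul_comm, div_mul_div_cancel₀ (pow_ne_zero _ hnpos)]

/-! ### Symmetries of the square acting on grids -/

/-- Reversal and negation both turn monotone into antitone, and the two stabilizers are conjugate
under `Fin.revPerm`. -/
theorem blockCoeff_comp_rev {k : ℕ} (f : Fin k → ℤ) :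
    blockCoeff (f ∘ Fin.revPerm) = blockCoeff (-f) := by
  classical
  have hm : Monotone (f ∘ Fin.revPerm) ↔ Monotone (-f) := by
    constructor
    · intro h i j hij
      have := h (Fin.rev_le_rev.2 hij)
      simp only [Function.comp_apply, Fin.revPerm_apply, Fin.rev_rev] at this
      simpa using this
    · intro h i j hij
      have := h (Fin.rev_le_rev.2 hij)
      simpa using this
  have hc : (Finset.univ.filter fun τ : Equiv.Perm (Fin k) =>
      (f ∘ Fin.revPerm) ∘ τ = f ∘ Fin.revPerm).card =
      (Finset.univ.filter fun τ : Equiv.Perm (Fin k) => (-f) ∘ τ = -f).card := by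
    apply Finset.card_equiv (MulAut.conj (Fin.revPerm : Equiv.Perm (Fin k))).toEquiv
    intro τ
    simp only [Finset.mem_filter, Finset.mem_univ, true_and, funext_iff, Function.comp_apply,
      Pi.neg_apply, neg_inj]
    constructor
    · intro h i
      simpa using h (Fin.rev i)
    · intro h i
      simpa using h (Fin.rev i)
  simp only [blockCoeff, hm]
  split_ifs
  · exact congrArg (fun z : ℕ => (z : ℝ)⁻¹) hc
  · rfl

section Symmetry

variable {L : Type*} [Fintype L] {k : ℕ} (col row : L → ℤ) (v : L → ℝ)
  (σ : Equiv.Perm (Fin k))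

theorem limitDensity_inv : limitDensity col row v σ⁻¹ = limitDensity row col v σ := by
  rw [limitDensity, limitDensity]
  congr 1
  apply Fintype.sum_equiv (Equiv.arrowCongr σ.symm (Equiv.refl L))
  intro s
  have h1 : (Equiv.arrowCongr σ.symm (Equiv.refl L)) s = s ∘ σ := rfl
  rw [h1]
  have h2 : ∏ i, v ((s ∘ σ) i) = ∏ i, v (s i) := Equiv.prod_comp σ fun i => v (s i)
  have h3 : (s ∘ σ) ∘ σ.symm = s := by funext i; simp
  rw [h2, h3, mul_comm (blockCoeff (row ∘ s ∘ σ))]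
  rfl

theorem limitDensity_mul_rev :
    limitDensity col row v (σ * Fin.revPerm) = limitDensity (-col) row v σ := by
  rw [limitDensity, limitDensity]
  congr 1
  apply Fintype.sum_equiv (Equiv.arrowCongr Fin.revPerm (Equiv.refl L))
  intro s
  have h1 : (Equiv.arrowCongr Fin.revPerm (Equiv.refl L)) s = s ∘ Fin.revPerm := rfl
  rw [h1]
  have h2 : ∏ i, v ((s ∘ Fin.revPerm) i) = ∏ i, v (s i) :=
    Equiv.prod_comp Fin.revPerm fun i => v (s i)
  have h3 : (-col) ∘ s ∘ Fin.revPerm = -((col ∘ s) ∘ Fin.revPerm) := rfl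
  have h4 : ((col ∘ s) ∘ Fin.revPerm) ∘ Fin.revPerm = col ∘ s := by funext i; simp
  rw [h2, h3, ← blockCoeff_comp_rev, h4]
  rfl

theorem limitDensity_rev_mul :
    limitDensity col row v (Fin.revPerm * σ) = limitDensity col (-row) v σ := by
  rw [limitDensity, limitDensity]
  congr 1
  apply Finset.sum_congr rfl
  intro s _
  have h3 : (-row) ∘ s ∘ σ.symm = -(row ∘ s ∘ σ.symm) := rfl
  rw [h3, ← blockCoeff_comp_rev]
  rfl

/-- Inverting a pattern exchanges columns and rows, and reversing its positions or values negates
the columns or rows. The weights never change. -/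
theorem exists_limitDensity_squareSymmetry (inv flipX flipY : Bool) :
    ∃ col' row' : L → ℤ, ∀ σ : Equiv.Perm (Fin k),
      limitDensity col' row' v σ = limitDensity col row v (squareSymmetry inv flipX flipY σ) := by
  have h1 : ∃ col₁ row₁ : L → ℤ, ∀ σ : Equiv.Perm (Fin k),
      limitDensity col₁ row₁ v σ =
        limitDensity col row v ((if flipY then Fin.revPerm else 1) * σ) := by
    cases flipY
    · exact ⟨col, row, fun σ => by simp⟩
    · exact ⟨col, -row, fun σ => by simp [limitDensity_rev_mul]⟩
  obtain ⟨col₁, row₁, h1⟩ := h1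
  have h2 : ∃ col₂ row₂ : L → ℤ, ∀ σ : Equiv.Perm (Fin k),
      limitDensity col₂ row₂ v σ =
        limitDensity col₁ row₁ v (σ * (if flipX then Fin.revPerm else 1)) := by
    cases flipX
    · exact ⟨col₁, row₁, fun σ => by simp⟩
    · exact ⟨-col₁, row₁, fun σ => by simp [limitDensity_mul_rev]⟩
  obtain ⟨col₂, row₂, h2⟩ := h2
  cases inv
  · exact ⟨col₂, row₂, fun σ => by rw [h2, h1, squareSymmetry, mul_assoc]; rfl⟩
  · refine ⟨row₂, col₂, fun σ => ?_⟩
    rw [← limitDensity_inv, h2, h1, squareSymmetry, mul_assoc]; rfl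

end Symmetry

/-! ### From approximate to exact solutions of quartic equations -/

theorem not_isQuasirandomForcing_of_limitDensity {L : Type*} [Fintype L] (col row : L → ℤ)
    (v : L → ℝ) (hv : ∀ l, 0 ≤ v l) (hv1 : ∑ l, v l = 1) (Z : Set FinPerm)
    (hZ : ∀ σ ∈ Z, limitDensity col row v σ.2 = 1 / (σ.1.factorial : ℝ)) (τ : FinPerm)
    (hτ : limitDensity col row v τ.2 ≠ 1 / (τ.1.factorial : ℝ)) :
    ¬ IsQuasirandomForcing Z := by
  intro h
  obtain ⟨p, hp, hlim⟩ := exists_seq_tendsto_limitDensity col row v hv hv1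
  have hq := (h p hp).2 fun σ hσ => by
    rw [← hZ σ hσ]
    exact hlim σ.1 σ.2
  exact hτ (tendsto_nhds_unique (hlim τ.1 τ.2) (hq.2 τ))

/-- A simplified Newton iteration: `x ↦ x - F x + z` is a `1 / 2`-contraction. It moves the centre
by at most `r / 2`, hence preserves the ball, and its fixed points are the solutions of `F x = z`.
-/
theorem exists_eq_of_norm_sub_sub_le {E : Type*} [NormedAddCommGroup E] [NormedSpace ℝ E]
    [CompleteSpace E] (F : E → E) {r : ℝ} (hr : 0 ≤ r)
    (hF : ∀ x ∈ Metric.closedBall (0 : E) r, ∀ y ∈ Metric.closedBall (0 : E) r,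
      ‖F x - F y - (x - y)‖ ≤ 1 / 2 * ‖x - y‖) (z : E) (hz : ‖F 0 - z‖ ≤ r / 2) :
    ∃ x ∈ Metric.closedBall (0 : E) r, F x = z := by
  have h0 : (0 : E) ∈ Metric.closedBall (0 : E) r := by simpa using hr
  have hcontr : LipschitzOnWith (1 / 2) (fun x => x - F x + z) (Metric.closedBall (0 : E) r) := by
    apply LipschitzOnWith.of_dist_le_mul
    intro x hx y hy
    rw [dist_eq_norm, dist_eq_norm]
    have h1 := hF x hx y hy
    have h2 : x - F x + z - (y - F y + z) = -(F x - F y - (x - y)) := by abel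
    rw [h2, norm_neg]
    simpa using h1
  have hmaps : Set.MapsTo (fun x => x - F x + z) (Metric.closedBall (0 : E) r)
      (Metric.closedBall (0 : E) r) := by
    intro x hx
    have h1 := hF x hx 0 h0
    rw [sub_zero] at h1
    rw [mem_closedBall_zero_iff] at hx ⊢
    have h2 : x - F x + z = -(F x - F 0 - x) - (F 0 - z) := by abel
    calc ‖x - F x + z‖ ≤ ‖F x - F 0 - x‖ + ‖F 0 - z‖ := by
          rw [h2, ← norm_neg (F x - F 0 - x)]; exact norm_sub_le _ _
      _ ≤ r := by linarith
  obtain ⟨x, hx, hfix, -⟩ := ContractingWith.exists_fixedPoint'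
    (Metric.isClosed_closedBall (x := (0 : E)) (ε := r)).isComplete hmaps
    (K := 1 / 2) ⟨by
      rw [← NNReal.coe_lt_coe]; norm_num, hcontr.mapsToRestrict hmaps⟩ h0 (edist_ne_top _ _)
  refine ⟨x, hx, ?_⟩
  have h3 : x - F x + z = x := hfix
  have h4 : z - F x = 0 := by
    have : x - F x + z = x + (z - F x) := by abel
    rw [this] at h3
    simpa using h3
  exact (sub_eq_zero.1 h4).symm

/-- Telescoping gives four terms, each a difference bounded by `δ` times the error, at most `3 * η`,
of replacing three factors by the corresponding factors at the base point. -/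
theorem abs_prod_four_sub_sub_le {a b c d a' b' c' d' w x y z δ η : ℝ}
    (ha' : |a'| ≤ 1) (hb' : |b'| ≤ 1) (hb : |b| ≤ 1) (hc : |c| ≤ 1)
    (hx : |x| ≤ 1) (hy : |y| ≤ 1) (hz : |z| ≤ 1)
    (da : |a - a'| ≤ δ) (db : |b - b'| ≤ δ) (dc : |c - c'| ≤ δ) (dd : |d - d'| ≤ δ)
    (ea' : |a' - w| ≤ η) (eb' : |b' - x| ≤ η) (ec' : |c' - y| ≤ η)
    (eb : |b - x| ≤ η) (ec : |c - y| ≤ η) (ed : |d - z| ≤ η) :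
    |a * b * c * d - a' * b' * c' * d' - ((a - a') * x * y * z + w * (b - b') * y * z +
      w * x * (c - c') * z + w * x * y * (d - d'))| ≤ 12 * δ * η := by
  have key : ∀ {p q r p' q' r' : ℝ}, |p| ≤ 1 → |q| ≤ 1 → |q'| ≤ 1 → |r'| ≤ 1 →
      |p - p'| ≤ η → |q - q'| ≤ η → |r - r'| ≤ η → |p * q * r - p' * q' * r'| ≤ 3 * η := by
    intro p q r p' q' r' h1 h2 h3 h4 h5 h6 h7
    have e : p * q * r - p' * q' * r' =
        p * q * (r - r') + p * (q - q') * r' + (p - p') * q' * r' := by ring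
    have hη : 0 ≤ η := (abs_nonneg _).trans h5
    have b1 : |p * q * (r - r')| ≤ η := by
      rw [abs_mul, abs_mul]
      calc |p| * |q| * |r - r'| ≤ 1 * 1 * η := by gcongr
        _ = η := by ring
    have b2 : |p * (q - q') * r'| ≤ η := by
      rw [abs_mul, abs_mul]
      calc |p| * |q - q'| * |r'| ≤ 1 * η * 1 := by gcongr
        _ = η := by ring
    have b3 : |(p - p') * q' * r'| ≤ η := by
      rw [abs_mul, abs_mul]
      calc |p - p'| * |q'| * |r'| ≤ η * 1 * 1 := by gcongr
        _ = η := by ring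
    rw [e]
    calc _ ≤ |p * q * (r - r')| + |p * (q - q') * r'| + |(p - p') * q' * r'| := abs_add_three _ _ _
      _ ≤ 3 * η := by linarith
  have hδ : 0 ≤ δ := (abs_nonneg _).trans da
  have e : a * b * c * d - a' * b' * c' * d' - ((a - a') * x * y * z + w * (b - b') * y * z +
      w * x * (c - c') * z + w * x * y * (d - d')) =
      (a - a') * (b * c * d - x * y * z) + (b - b') * (a' * c * d - w * y * z) +
      (c - c') * (a' * b' * d - w * x * z) + (d - d') * (a' * b' * c' - w * x * y) := by ring
  have m : ∀ {u t : ℝ}, |u| ≤ δ → |t| ≤ 3 * η → |u * t| ≤ 3 * δ * η := by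
    intro u t h1 h2
    rw [abs_mul]
    calc |u| * |t| ≤ δ * (3 * η) := by gcongr
      _ = 3 * δ * η := by ring
  have m1 := m da (key hb hc hy hz eb ec ed)
  have m2 := m db (key ha' hc hy hz ea' ec ed)
  have m3 := m dc (key ha' hb' hx hz ea' eb' ed)
  have m4 := m dd (key ha' hb' hx hy ea' eb' ec')
  rw [e]
  calc _ ≤ |(a - a') * (b * c * d - x * y * z)| + |(b - b') * (a' * c * d - w * y * z)| +
      |(c - c') * (a' * b' * d - w * x * z)| + |(d - d') * (a' * b' * c' - w * x * y)| :=
        (abs_add_le _ _).trans (add_le_add (abs_add_three _ _ _) le_rfl)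
    _ ≤ 12 * δ * η := by linarith

section Quartic

variable {R : Type*} [CommRing R] {L : Type*} [Fintype L]

/-- The quartic form with coefficients `c`. -/
def quarticForm (c : (Fin 4 → L) → R) (x : L → R) : R :=
  ∑ s, c s * (x (s 0) * x (s 1) * x (s 2) * x (s 3))

/-- The derivative of `quarticForm c` at `w` in the direction `g`. -/
def quarticDeriv (c : (Fin 4 → L) → R) (w g : L → R) : R :=
  ∑ s, c s * (g (s 0) * w (s 1) * w (s 2) * w (s 3) + w (s 0) * g (s 1) * w (s 2) * w (s 3) +
    w (s 0) * w (s 1) * g (s 2) * w (s 3) + w (s 0) * w (s 1) * w (s 2) * g (s 3))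

theorem quarticDeriv_sum {ι : Type*} [Fintype ι] (c : (Fin 4 → L) → R) (w : L → R)
    (g : ι → L → R) (t : ι → R) :
    quarticDeriv c w (fun l => ∑ j, t j * g j l) = ∑ j, t j * quarticDeriv c w (g j) := by
  simp only [quarticDeriv, Finset.mul_sum, Finset.sum_mul]
  rw [Finset.sum_comm]
  apply Finset.sum_congr rfl
  intro s _
  simp only [← Finset.sum_add_distrib, Finset.mul_sum]
  apply Finset.sum_congr rfl
  intro j _
  ring

end Quartic

theorem abs_quarticForm_sub_sub_le {L : Type*} [Fintype L] (c : (Fin 4 → L) → ℝ)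
    (w x y : L → ℝ) {C δ η : ℝ} (hc : ∑ s, |c s| ≤ C) (hw : ∀ l, |w l| ≤ 1)
    (hx : ∀ l, |x l| ≤ 1) (hy : ∀ l, |y l| ≤ 1) (hxy : ∀ l, |x l - y l| ≤ δ)
    (hxw : ∀ l, |x l - w l| ≤ η) (hyw : ∀ l, |y l - w l| ≤ η) (hδη : 0 ≤ δ * η) :
    |quarticForm c x - quarticForm c y - quarticDeriv c w (fun l => x l - y l)| ≤
      C * (12 * δ * η) := by
  rw [quarticForm, quarticForm, quarticDeriv, ← Finset.sum_sub_distrib, ← Finset.sum_sub_distrib]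
  calc _ ≤ ∑ s, |c s| * (12 * δ * η) := by
        apply (Finset.abs_sum_le_sum_abs _ _).trans
        apply Finset.sum_le_sum
        intro s _
        rw [← mul_sub, ← mul_sub, abs_mul]
        apply mul_le_mul_of_nonneg_left _ (abs_nonneg _)
        exact abs_prod_four_sub_sub_le (hy _) (hy _) (hx _) (hx _) (hw _)
          (hw _) (hw _) (hxy _) (hxy _) (hxy _) (hxy _) (hyw _) (hyw _) (hyw _) (hxw _) (hxw _)
          (hxw _)
    _ ≤ _ := by
        rw [← Finset.sum_mul]
        exact mul_le_mul_of_nonneg_right hc (by linarith)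

/-- As a map of `t` in the sup norm, the derivative at `w` is within `1 / 4` of the identity by
`h1`, and by `h2` the nonlinearity costs another `1 / 4`. Together they give the constant `1 / 2` of
the contraction argument. -/
theorem exists_quarticForm_eq_one {L : Type*} [Fintype L] {ι : Type*} [Fintype ι] [DecidableEq ι]
    (c : ι → (Fin 4 → L) → ℝ) (w : L → ℝ) (g : ι → L → ℝ) {C G r : ℝ} (hr : 0 ≤ r)
    (hG : 0 ≤ G)
    (hc : ∀ i, ∑ s, |c i s| ≤ C) (hg : ∀ l, ∑ j, |g j l| ≤ G) (hw : ∀ l, |w l| ≤ 1)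
    (hwr : ∀ l, |w l| + G * r ≤ 1)
    (h0 : ∀ i, |quarticForm (c i) w - 1| ≤ r / 2)
    (h1 : ∀ i, ∑ j, |quarticDeriv (c i) w (g j) - if i = j then 1 else 0| ≤ 1 / 4)
    (h2 : C * (12 * G * (G * r)) ≤ 1 / 4) :
    ∃ t : ι → ℝ, ‖t‖ ≤ r ∧ ∀ i, quarticForm (c i) (fun l => w l + ∑ j, t j * g j l) = 1 := by
  have hlin : ∀ (t : ι → ℝ) (l : L), |∑ j, t j * g j l| ≤ G * ‖t‖ := by
    intro t l
    calc |∑ j, t j * g j l| ≤ ∑ j, |g j l| * ‖t‖ := by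
          apply (Finset.abs_sum_le_sum_abs _ _).trans
          apply Finset.sum_le_sum
          intro j _
          rw [abs_mul, mul_comm]
          exact mul_le_mul_of_nonneg_left (norm_le_pi_norm t j) (abs_nonneg _)
      _ ≤ G * ‖t‖ := by
          rw [← Finset.sum_mul]
          exact mul_le_mul_of_nonneg_right (hg l) (norm_nonneg _)
  have hnear : ∀ t : ι → ℝ, ‖t‖ ≤ r → ∀ l, |w l + ∑ j, t j * g j l - w l| ≤ G * r := by
    intro t ht l
    rw [add_sub_cancel_left]
    exact (hlin t l).trans (mul_le_mul_of_nonneg_left ht hG)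
  have hone : ∀ t : ι → ℝ, ‖t‖ ≤ r → ∀ l, |w l + ∑ j, t j * g j l| ≤ 1 := by
    intro t ht l
    refine (abs_add_le _ _).trans (le_trans ?_ (hwr l))
    have := hnear t ht l
    rw [add_sub_cancel_left] at this
    linarith
  obtain ⟨t, ht, hFt⟩ := exists_eq_of_norm_sub_sub_le
    (fun (t : ι → ℝ) (i : ι) => quarticForm (c i) (fun l => w l + ∑ j, t j * g j l)) hr (by
      intro t ht u hu
      rw [mem_closedBall_zero_iff] at ht hu
      rw [pi_norm_le_iff_of_nonneg (by positivity)]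
      intro i
      rw [Real.norm_eq_abs]
      have hd : ∀ l, (w l + ∑ j, t j * g j l) - (w l + ∑ j, u j * g j l) =
          ∑ j, (t - u) j * g j l := by
        intro l
        simp only [Pi.sub_apply, sub_mul, Finset.sum_sub_distrib]
        ring
      have b1 := abs_quarticForm_sub_sub_le (c i) w (fun l => w l + ∑ j, t j * g j l)
        (fun l => w l + ∑ j, u j * g j l) (hc i) hw (hone t ht) (hone u hu)
        (δ := G * ‖t - u‖) (η := G * r) (fun l => by rw [hd]; exact hlin _ l)
        (hnear t ht) (hnear u hu) (by positivity)
      simp only [hd] at b1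
      rw [quarticDeriv_sum] at b1
      have b2 : |∑ j, (t - u) j * quarticDeriv (c i) w (g j) - (t - u) i| ≤
          1 / 4 * ‖t - u‖ := by
        have e : ∑ j, (t - u) j * quarticDeriv (c i) w (g j) - (t - u) i =
            ∑ j, (t - u) j * (quarticDeriv (c i) w (g j) - if i = j then 1 else 0) := by
          simp [mul_sub, Finset.sum_sub_distrib]
        rw [e]
        calc _ ≤ ∑ j, |quarticDeriv (c i) w (g j) - if i = j then 1 else 0| * ‖t - u‖ := by
              apply (Finset.abs_sum_le_sum_abs _ _).trans
              apply Finset.sum_le_sum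
              intro j _
              rw [abs_mul, mul_comm]
              exact mul_le_mul_of_nonneg_left (norm_le_pi_norm (t - u) j) (abs_nonneg _)
          _ ≤ _ := by
              rw [← Finset.sum_mul]
              exact mul_le_mul_of_nonneg_right (h1 i) (norm_nonneg _)
      have b3 : C * (12 * (G * ‖t - u‖) * (G * r)) ≤ 1 / 4 * ‖t - u‖ := by
        have := mul_le_mul_of_nonneg_right h2 (norm_nonneg (t - u))
        linarith
      simp only [Pi.sub_apply] at b1 b2 ⊢
      rw [abs_le] at b1 b2 ⊢
      constructor <;> linarith [b1.1, b1.2, b2.1, b2.2]) 1 (by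
      rw [pi_norm_le_iff_of_nonneg (by positivity)]
      intro i
      simpa using h0 i)
  exact ⟨t, by simpa using ht, fun i => congrFun hFt i⟩

/-! ### Integer certificates -/

/-- `24` times the probability that four uniformly random points in the blocks `a, b, c, d` are
increasing. -/
def blockWeight (a b c d : ℕ) : ℕ :=
  bif Nat.ble a b && Nat.ble b c && Nat.ble c d then
    bif Nat.beq a b then
      bif Nat.beq b c then (bif Nat.beq c d then 1 else 4)
      else (bif Nat.beq c d then 6 else 12)
    else
      bif Nat.beq b c then (bif Nat.beq c d then 4 else 12)
      else (bif Nat.beq c d then 12 else 24)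
  else 0

/-- A cell of a grid with a weight and four directions in which the weight may be varied. -/
structure Cell where
  /-- The column of the cell. -/
  col : ℕ
  /-- The row of the cell. -/
  row : ℕ
  /-- The weight of the cell. -/
  weight : ℕ
  /-- The directions of variation of the weight. -/
  dir : Fin 4 → ℤ

/-- `576` times the probability that random points in four cells form the pattern whose inverse
is `ρ`. -/
def patternWeight (ρ : Fin 4 → Fin 4) (a b c d : Cell) : ℕ :=
  match blockWeight a.col b.col c.col d.col with
  | 0 => 0
  | k + 1 => (k + 1) * blockWeight (![a.row, b.row, c.row, d.row] (ρ 0))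
      (![a.row, b.row, c.row, d.row] (ρ 1)) (![a.row, b.row, c.row, d.row] (ρ 2))
      (![a.row, b.row, c.row, d.row] (ρ 3))

/-- The product of `w` and `x`, arranged so that `x` is not evaluated if `w = 0`. -/
def lazyMul (w : ℕ) (x : ℤ) : ℤ :=
  match w with
  | 0 => 0
  | k + 1 => ((k + 1 : ℕ) : ℤ) * x

/-- The weighted sum of `F` over all quadruples of cells. -/
def quadrupleSum (cells : List Cell) (ρ : Fin 4 → Fin 4) (F : Cell → Cell → Cell → Cell → ℤ) : ℤ :=
  (cells.map fun a => (cells.map fun b => bif Nat.ble a.col b.col then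
    (cells.map fun c => bif Nat.ble b.col c.col then
      (cells.map fun d => lazyMul (patternWeight ρ a b c d) (F a b c d)).sum
    else 0).sum else 0).sum).sum

/-- `24` times the density of the pattern with inverse `ρ`, in terms of the integer weights. -/
def cellForm (cells : List Cell) (ρ : Fin 4 → Fin 4) : ℤ :=
  quadrupleSum cells ρ fun a b c d => ((a.weight * b.weight * c.weight * d.weight : ℕ) : ℤ)

/-- The derivative of `cellForm` in the direction `j`. -/
def cellDeriv (cells : List Cell) (ρ : Fin 4 → Fin 4) (j : Fin 4) : ℤ :=
  quadrupleSum cells ρ fun a b c d =>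
    a.dir j * ((b.weight * c.weight * d.weight : ℕ) : ℤ) +
      ((a.weight * c.weight * d.weight : ℕ) : ℤ) * b.dir j +
      ((a.weight * b.weight * d.weight : ℕ) : ℤ) * c.dir j +
      ((a.weight * b.weight * c.weight : ℕ) : ℤ) * d.dir j

/-- Numerical conditions under which weights close to those of `cells` give exactly the density
`1 / 24` to the patterns with inverses `ρ i`, and another density to the one with inverse `τ`. -/
def IsCertificate (cells : List Cell) (ρ : Fin 4 → Fin 4 → Fin 4) (τ : Fin 4 → Fin 4) : Prop :=
  cells.length ≤ 7 ∧
  (cells.map Cell.weight).sum = 10 ^ 12 ∧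
  (∀ j, (cells.map fun a => a.dir j).sum = 0) ∧
  (∀ a ∈ cells, ∑ j, |a.dir j| ≤ 3000 ∧ ∑ j, |a.dir j| ≤ a.weight ∧
    a.weight + 3000 ≤ 10 ^ 12) ∧
  (∀ i, |cellForm cells (ρ i) - 10 ^ 48| * (2 * 10 ^ 9) ≤ 10 ^ 48) ∧
  (∀ i, (∑ j, |cellDeriv cells (ρ i) j - if i = j then 10 ^ 39 else 0|) * 4 ≤ 10 ^ 39) ∧
  10 ^ 48 ≤ |cellForm cells τ - 10 ^ 48| * 20

instance (cells : List Cell) (ρ : Fin 4 → Fin 4 → Fin 4) (τ : Fin 4 → Fin 4) :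
    Decidable (IsCertificate cells ρ τ) := by
  unfold IsCertificate; infer_instance

theorem stabilizer_card_of_eq_iff {k : ℕ} {α β : Type*} [DecidableEq α] [DecidableEq β]
    (f : Fin k → α) (e : Fin k → β) (h : ∀ i j, f i = f j ↔ e i = e j) :
    (Finset.univ.filter fun τ : Equiv.Perm (Fin k) => f ∘ τ = f).card =
      (Finset.univ.filter fun τ : Equiv.Perm (Fin k) => e ∘ τ = e).card := by
  congr 1
  ext τ
  simp only [Finset.mem_filter, Finset.mem_univ, true_and, funext_iff, Function.comp_apply, h]

/-- The stabilizer depends only on which values of `f` coincide, so it may be computed on a concrete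
model `e`. -/
theorem blockCoeff_of_eq_iff {f : Fin 4 → ℤ} (hf : Monotone f) (e : Fin 4 → Fin 4) (c : ℕ)
    (h : ∀ i j, f i = f j ↔ e i = e j)
    (hc : c * (Finset.univ.filter fun τ : Equiv.Perm (Fin 4) => e ∘ τ = e).card = 24) :
    blockCoeff f = (c : ℝ) / 24 := by
  have h1 := stabilizer_card_of_eq_iff f e h
  have h2 : (Finset.univ.filter fun τ : Equiv.Perm (Fin 4) => e ∘ τ = e).card ≠ 0 := by
    intro h0
    rw [h0] at hc
    omega
  rw [blockCoeff, if_pos hf]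
  have h3 : ((Finset.univ.filter fun τ : Equiv.Perm (Fin 4) => e ∘ τ = e).card : ℝ) ≠ 0 := by
    exact_mod_cast h2
  have h4 : (c : ℝ) * (Finset.univ.filter fun τ : Equiv.Perm (Fin 4) => e ∘ τ = e).card = 24 := by
    exact_mod_cast hc
  have h5 : ((Finset.univ.filter fun τ : Equiv.Perm (Fin 4) => f ∘ τ = f).card : ℝ) =
      ((Finset.univ.filter fun τ : Equiv.Perm (Fin 4) => e ∘ τ = e).card : ℝ) := by
    exact_mod_cast h1
  convert (?_ : ((Finset.univ.filter fun τ : Equiv.Perm (Fin 4) => f ∘ τ = f).card : ℝ)⁻¹ = _)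
    using 3
  rw [h5]
  field_simp
  linarith

theorem monotone_fin_four_iff (f : Fin 4 → ℤ) :
    Monotone f ↔ f 0 ≤ f 1 ∧ f 1 ≤ f 2 ∧ f 2 ≤ f 3 := by
  rw [Fin.monotone_iff_le_succ]
  constructor
  · intro h
    exact ⟨h 0, h 1, h 2⟩
  · rintro ⟨h0, h1, h2⟩ i
    fin_cases i
    · exact h0
    · exact h1
    · exact h2

theorem blockCoeff_eq_blockWeight (f : Fin 4 → ℤ) (a b c d : ℕ) (ha : f 0 = a) (hb : f 1 = b)
    (hc : f 2 = c) (hd : f 3 = d) : blockCoeff f = (blockWeight a b c d : ℝ) / 24 := by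
  by_cases hm : Monotone f
  swap
  · have h1 : ¬ (a ≤ b ∧ b ≤ c ∧ c ≤ d) := by
      intro h
      apply hm
      rw [monotone_fin_four_iff, ha, hb, hc, hd]
      exact_mod_cast h
    have h2 : (Nat.ble a b && Nat.ble b c && Nat.ble c d) = false := by
      rw [← Bool.not_eq_true]
      simpa [and_assoc] using h1
    rw [blockCoeff, if_neg hm, blockWeight, h2]
    simp
  have h1 : a ≤ b ∧ b ≤ c ∧ c ≤ d := by
    have := (monotone_fin_four_iff f).1 hm
    rw [ha, hb, hc, hd] at this
    exact_mod_cast this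
  obtain ⟨hab, hbc, hcd⟩ := h1
  have h2 : (Nat.ble a b && Nat.ble b c && Nat.ble c d) = true := by
    simp [hab, hbc, hcd]
  rw [blockWeight, h2]
  have beq : ∀ {x y : ℕ}, x = y → Nat.beq x y = true := fun h => by simp [h]
  have bne : ∀ {x y : ℕ}, x < y → Nat.beq x y = false := fun h => by
    rw [← Bool.not_eq_true, Nat.beq_eq]; exact h.ne
  -- Eight cases, one for each composition of 4 into block sizes; the model sends every index to the
  -- first index of its block.
  rcases hab.eq_or_lt with h01 | h01 <;> rcases hbc.eq_or_lt with h12 | h12 <;>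
    rcases hcd.eq_or_lt with h23 | h23
  · rw [beq h01, beq h12, beq h23]
    refine blockCoeff_of_eq_iff hm ![0, 0, 0, 0] _ ?_ (by decide)
    simp [Fin.forall_fin_succ, ha, hb, hc, hd]; omega
  · rw [beq h01, beq h12, bne h23]
    refine blockCoeff_of_eq_iff hm ![0, 0, 0, 3] _ ?_ (by decide)
    simp [Fin.forall_fin_succ, ha, hb, hc, hd]; omega
  · rw [beq h01, bne h12, beq h23]
    refine blockCoeff_of_eq_iff hm ![0, 0, 2, 2] _ ?_ (by decide)
    simp [Fin.forall_fin_succ, ha, hb, hc, hd]; omega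
  · rw [beq h01, bne h12, bne h23]
    refine blockCoeff_of_eq_iff hm ![0, 0, 2, 3] _ ?_ (by decide)
    simp [Fin.forall_fin_succ, ha, hb, hc, hd]; omega
  · rw [bne h01, beq h12, beq h23]
    refine blockCoeff_of_eq_iff hm ![0, 1, 1, 1] _ ?_ (by decide)
    simp [Fin.forall_fin_succ, ha, hb, hc, hd]; omega
  · rw [bne h01, beq h12, bne h23]
    refine blockCoeff_of_eq_iff hm ![0, 1, 1, 3] _ ?_ (by decide)
    simp [Fin.forall_fin_succ, ha, hb, hc, hd]; omega
  · rw [bne h01, bne h12, beq h23]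
    refine blockCoeff_of_eq_iff hm ![0, 1, 2, 2] _ ?_ (by decide)
    simp [Fin.forall_fin_succ, ha, hb, hc, hd]; omega
  · rw [bne h01, bne h12, bne h23]
    refine blockCoeff_of_eq_iff hm ![0, 1, 2, 3] _ ?_ (by decide)
    simp [Fin.forall_fin_succ, ha, hb, hc, hd]; omega

theorem blockWeight_le (a b c d : ℕ) : blockWeight a b c d ≤ 24 := by
  unfold blockWeight
  cases Nat.ble a b && Nat.ble b c && Nat.ble c d <;> cases Nat.beq a b <;>
    cases Nat.beq b c <;> cases Nat.beq c d <;> simp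

/-- The coefficients of the density of the pattern with inverse `ρ` as a quartic form. -/
def cellCoeff (cells : List Cell) (ρ : Fin 4 → Fin 4) (s : Fin 4 → Fin cells.length) : ℕ :=
  patternWeight ρ (cells.get (s 0)) (cells.get (s 1)) (cells.get (s 2)) (cells.get (s 3))

theorem patternWeight_eq (ρ : Fin 4 → Fin 4) (a b c d : Cell) :
    patternWeight ρ a b c d = blockWeight a.col b.col c.col d.col *
      blockWeight (![a.row, b.row, c.row, d.row] (ρ 0)) (![a.row, b.row, c.row, d.row] (ρ 1))
        (![a.row, b.row, c.row, d.row] (ρ 2)) (![a.row, b.row, c.row, d.row] (ρ 3)) := by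
  unfold patternWeight
  split
  · rename_i h; rw [h, zero_mul]
  · rename_i h; rw [h]

theorem patternWeight_eq_zero (ρ : Fin 4 → Fin 4) {a b c d : Cell}
    (h : ¬ (a.col ≤ b.col ∧ b.col ≤ c.col)) : patternWeight ρ a b c d = 0 := by
  have h1 : (Nat.ble a.col b.col && Nat.ble b.col c.col && Nat.ble c.col d.col) = false := by
    rw [← Bool.not_eq_true]
    simp only [Bool.and_eq_true, Nat.ble_eq]
    tauto
  rw [patternWeight_eq, blockWeight, h1, cond_false, zero_mul]

theorem patternWeight_le (ρ : Fin 4 → Fin 4) (a b c d : Cell) :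
    patternWeight ρ a b c d ≤ 576 := by
  rw [patternWeight_eq]
  exact Nat.mul_le_mul (blockWeight_le _ _ _ _) (blockWeight_le _ _ _ _)

/-- The factor `4! / 576 = 1 / 24` makes density `1 / 24` correspond to the value `1` of the form.
-/
theorem limitDensity_eq_quarticForm (cells : List Cell) (v : Fin cells.length → ℝ)
    (σ : Equiv.Perm (Fin 4)) :
    limitDensity (fun l => ((cells.get l).col : ℤ)) (fun l => ((cells.get l).row : ℤ)) v σ =
      quarticForm (fun s => (cellCoeff cells σ.symm s : ℝ)) v / 24 := by
  rw [limitDensity, quarticForm, Finset.mul_sum, Finset.sum_div]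
  apply Finset.sum_congr rfl
  intro s _
  have hrow : ∀ i : Fin 4, ((fun l => ((cells.get l).row : ℤ)) ∘ s ∘ σ.symm) i =
      ((![(cells.get (s 0)).row, (cells.get (s 1)).row, (cells.get (s 2)).row,
        (cells.get (s 3)).row] (σ.symm i) : ℕ) : ℤ) := by
    intro i
    simp only [Function.comp_apply]
    generalize σ.symm i = j
    fin_cases j <;> rfl
  rw [blockCoeff_eq_blockWeight _ _ _ _ _ rfl rfl rfl rfl,
    blockCoeff_eq_blockWeight _ _ _ _ _ (hrow 0) (hrow 1) (hrow 2) (hrow 3), cellCoeff,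
    patternWeight_eq, Fin.prod_univ_four]
  push_cast
  norm_num [Nat.factorial]
  ring

theorem sum_tuple_four {n : ℕ} {A : Type*} [AddCommMonoid A] (F : Fin n → Fin n → Fin n → Fin n → A) :
    ∑ s : Fin 4 → Fin n, F (s 0) (s 1) (s 2) (s 3) = ∑ a, ∑ b, ∑ c, ∑ d, F a b c d := by
  simp_rw [← Fintype.sum_prod_type']
  let e : (Fin 4 → Fin n) ≃ Fin n × Fin n × Fin n × Fin n :=
    { toFun := fun s => (s 0, s 1, s 2, s 3)
      invFun := fun q => ![q.1, q.2.1, q.2.2.1, q.2.2.2]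
      left_inv := fun s => by
        funext i
        fin_cases i <;> rfl
      right_inv := fun q => rfl }
  exact Fintype.sum_equiv e (fun s => F (s 0) (s 1) (s 2) (s 3))
    (fun q => F q.1 q.2.1 q.2.2.1 q.2.2.2) fun s => rfl

theorem sum_map_eq_sum_get {α A : Type*} [AddCommMonoid A] (l : List α) (G : α → A) :
    (l.map G).sum = ∑ i, G (l.get i) := by
  simp [List.get_eq_getElem]

theorem lazyMul_eq (w : ℕ) (x : ℤ) : lazyMul w x = w * x := by
  cases w <;> simp [lazyMul]

/-- The branches cut off in `quadrupleSum` have decreasing columns somewhere, so their coefficients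
vanish. -/
theorem quadrupleSum_eq (cells : List Cell) (ρ : Fin 4 → Fin 4)
    (F : Cell → Cell → Cell → Cell → ℤ) :
    quadrupleSum cells ρ F = ∑ s : Fin 4 → Fin cells.length, (cellCoeff cells ρ s : ℤ) *
      F (cells.get (s 0)) (cells.get (s 1)) (cells.get (s 2)) (cells.get (s 3)) := by
  have h := sum_tuple_four fun a b c d : Fin cells.length =>
    (patternWeight ρ (cells.get a) (cells.get b) (cells.get c) (cells.get d) : ℤ) *
      F (cells.get a) (cells.get b) (cells.get c) (cells.get d)
  simp only [cellCoeff]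
  rw [h, quadrupleSum]
  simp only [lazyMul_eq, sum_map_eq_sum_get]
  refine Finset.sum_congr rfl fun a _ => Finset.sum_congr rfl fun b _ => ?_
  by_cases hab : (cells.get a).col ≤ (cells.get b).col
  · rw [Nat.ble_eq_true_of_le hab, cond_true]
    refine Finset.sum_congr rfl fun c _ => ?_
    by_cases hbc : (cells.get b).col ≤ (cells.get c).col
    · rw [Nat.ble_eq_true_of_le hbc, cond_true]
    · rw [Bool.eq_false_iff.2 (mt Nat.le_of_ble_eq_true hbc), cond_false]
      refine (Finset.sum_eq_zero fun d _ => ?_).symm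
      rw [patternWeight_eq_zero ρ fun h => hbc h.2, Nat.cast_zero, zero_mul]
  · rw [Bool.eq_false_iff.2 (mt Nat.le_of_ble_eq_true hab), cond_false]
    refine (Finset.sum_eq_zero fun c _ => Finset.sum_eq_zero fun d _ => ?_).symm
    rw [patternWeight_eq_zero ρ fun h => hab h.1, Nat.cast_zero, zero_mul]

theorem abs_quarticForm_sub_le {L : Type*} [Fintype L] (c : (Fin 4 → L) → ℝ)
    (x y : L → ℝ) {C η : ℝ} (hc : ∑ s, |c s| ≤ C) (hx : ∀ l, |x l| ≤ 1) (hy : ∀ l, |y l| ≤ 1)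
    (hxy : ∀ l, |x l - y l| ≤ η) (hη : 0 ≤ η) :
    |quarticForm c x - quarticForm c y| ≤ C * (4 * η) := by
  rw [quarticForm, quarticForm, ← Finset.sum_sub_distrib]
  calc _ ≤ ∑ s, |c s| * (4 * η) := by
        apply (Finset.abs_sum_le_sum_abs _ _).trans
        apply Finset.sum_le_sum
        intro s _
        rw [← mul_sub, abs_mul]
        apply mul_le_mul_of_nonneg_left _ (abs_nonneg _)
        have h : ∀ {p q p' q' : ℝ} {α β : ℝ}, |p| ≤ 1 → |q'| ≤ 1 → |p - p'| ≤ α →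
            |q - q'| ≤ β → |p * q - p' * q'| ≤ α + β := by
          intro p q p' q' α β h1 h2 h3 h4
          have e : p * q - p' * q' = p * (q - q') + (p - p') * q' := by ring
          have hα : 0 ≤ α := (abs_nonneg _).trans h3
          rw [e]
          refine (abs_add_le _ _).trans ?_
          rw [abs_mul, abs_mul]
          have b1 : |p| * |q - q'| ≤ 1 * β := by gcongr
          have b2 : |p - p'| * |q'| ≤ α * 1 := by gcongr
          linarith
        have m : ∀ {p q : ℝ}, |p| ≤ 1 → |q| ≤ 1 → |p * q| ≤ 1 := by
          intro p q h1 h2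
          rw [abs_mul]
          exact mul_le_one₀ h1 (abs_nonneg _) h2
        have h1 := h (hx (s 0)) (hy (s 1)) (hxy (s 0)) (hxy (s 1))
        have h2 := h (m (hx (s 0)) (hx (s 1))) (hy (s 2)) h1 (hxy (s 2))
        have h3 := h (m (m (hx (s 0)) (hx (s 1))) (hx (s 2))) (hy (s 3)) h2 (hxy (s 3))
        linarith
    _ ≤ _ := by
        rw [← Finset.sum_mul]
        exact mul_le_mul_of_nonneg_right hc (by linarith)

theorem cellForm_eq (cells : List Cell) (ρ : Fin 4 → Fin 4) :
    (cellForm cells ρ : ℝ) / 10 ^ 48 = quarticForm (fun s => (cellCoeff cells ρ s : ℝ))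
      fun l => ((cells.get l).weight : ℝ) / 10 ^ 12 := by
  rw [cellForm, quadrupleSum_eq, quarticForm]
  push_cast
  rw [Finset.sum_div]
  apply Finset.sum_congr rfl
  intro s _
  ring

theorem cellDeriv_eq (cells : List Cell) (ρ : Fin 4 → Fin 4) (j : Fin 4) :
    (cellDeriv cells ρ j : ℝ) / 10 ^ 39 = quarticDeriv (fun s => (cellCoeff cells ρ s : ℝ))
      (fun l => ((cells.get l).weight : ℝ) / 10 ^ 12)
      fun l => ((cells.get l).dir j : ℝ) / 1000 := by
  rw [cellDeriv, quadrupleSum_eq, quarticDeriv]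
  push_cast
  rw [Finset.sum_div]
  apply Finset.sum_congr rfl
  intro s _
  ring

theorem sum_abs_cellCoeff_le (cells : List Cell) (h : cells.length ≤ 7) (ρ : Fin 4 → Fin 4) :
    ∑ s, |(cellCoeff cells ρ s : ℝ)| ≤ 1382976 := by
  calc ∑ s, |(cellCoeff cells ρ s : ℝ)| ≤ ∑ s : Fin 4 → Fin cells.length, (576 : ℝ) := by
        apply Finset.sum_le_sum
        intro s _
        rw [Nat.abs_cast]
        exact_mod_cast patternWeight_le ρ _ _ _ _
    _ = (cells.length : ℝ) ^ 4 * 576 := by simp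
    _ ≤ (7 : ℝ) ^ 4 * 576 := by
        have : (cells.length : ℝ) ≤ 7 := by exact_mod_cast h
        gcongr
    _ = 1382976 := by norm_num

/-- Weights are in units of `10 ^ (-12)` and directions in units of `10 ^ (-3)`, so forms scale by
`10 ^ 48` and derivatives by `10 ^ 39`. Directions of total zero preserve the total mass, and a
total variation at most the weight of the cell keeps the new weights nonnegative. -/
theorem IsCertificate.exists_weights {cells : List Cell} {ρ : Fin 4 → Fin 4 → Fin 4}
    {τ : Fin 4 → Fin 4} (h : IsCertificate cells ρ τ) :
    ∃ v : Fin cells.length → ℝ, (∀ l, 0 ≤ v l) ∧ ∑ l, v l = 1 ∧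
      (∀ i, quarticForm (fun s => (cellCoeff cells (ρ i) s : ℝ)) v = 1) ∧
      quarticForm (fun s => (cellCoeff cells τ s : ℝ)) v ≠ 1 := by
  obtain ⟨hlen, hsum, hdir, hcell, hform, hderiv, hτ⟩ := h
  set w : Fin cells.length → ℝ := fun l => ((cells.get l).weight : ℝ) / 10 ^ 12 with hw
  set g : Fin 4 → Fin cells.length → ℝ := fun j l => ((cells.get l).dir j : ℝ) / 1000 with hg
  have hcell' : ∀ l : Fin cells.length, ∑ j, |((cells.get l).dir j : ℝ)| ≤ 3000 ∧
      ∑ j, |((cells.get l).dir j : ℝ)| ≤ (cells.get l).weight ∧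
      ((cells.get l).weight : ℝ) + 3000 ≤ 10 ^ 12 := by
    intro l
    have := hcell (cells.get l) (List.get_mem _ _)
    exact_mod_cast this
  have hgsum : ∀ l, ∑ j, |g j l| = (∑ j, |((cells.get l).dir j : ℝ)|) / 1000 := by
    intro l
    rw [Finset.sum_div]
    apply Finset.sum_congr rfl
    intro j _
    rw [hg, abs_div, abs_of_pos (show (0 : ℝ) < 1000 by norm_num)]
  have hw0 : ∀ l, 0 ≤ w l := fun l => by positivity
  have hwr : ∀ l, |w l| + 3 * (1 / 10 ^ 9 : ℝ) ≤ 1 := by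
    intro l
    rw [abs_of_nonneg (hw0 l), hw]
    have := (hcell' l).2.2
    simp only
    rw [div_add' _ _ _ (by norm_num), div_le_one (by norm_num)]
    linarith
  obtain ⟨t, ht, heq⟩ := exists_quarticForm_eq_one
    -- Here `C = 7 ^ 4 * 576` bounds the coefficients of at most seven cells, and `G = 3` is the
    -- bound 3000 on the directions after scaling.
    (fun i s => (cellCoeff cells (ρ i) s : ℝ)) w g (C := 1382976) (G := 3) (r := 1 / 10 ^ 9)
    (by norm_num) (by norm_num) (fun i => sum_abs_cellCoeff_le cells hlen (ρ i))
    (fun l => by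
      rw [hgsum]
      have := (hcell' l).1
      linarith)
    (fun l => by
      have := hwr l
      norm_num at this ⊢
      linarith) hwr
    (fun i => by
      have h1 : |(cellForm cells (ρ i) : ℝ) - 10 ^ 48| * (2 * 10 ^ 9) ≤ 10 ^ 48 := by
        exact_mod_cast hform i
      rw [← cellForm_eq, div_sub_one (by norm_num), abs_div,
        abs_of_pos (show (0 : ℝ) < 10 ^ 48 by norm_num), div_le_iff₀ (by norm_num)]
      norm_num at h1 ⊢
      linarith)
    (fun i => by
      have h1 : (∑ j, |(cellDeriv cells (ρ i) j : ℝ) - if i = j then 10 ^ 39 else 0|) * 4 ≤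
          10 ^ 39 := by
        exact_mod_cast hderiv i
      have h2 : ∀ j, |quarticDeriv (fun s => (cellCoeff cells (ρ i) s : ℝ)) w (g j) -
          (if i = j then 1 else 0)| =
          |(cellDeriv cells (ρ i) j : ℝ) - if i = j then 10 ^ 39 else 0| / 10 ^ 39 := by
        intro j
        rw [← cellDeriv_eq, ← abs_of_pos (show (0 : ℝ) < 10 ^ 39 by norm_num), ← abs_div,
          abs_of_pos (show (0 : ℝ) < 10 ^ 39 by norm_num), sub_div]
        congr 2
        split_ifs <;> norm_num
      simp only [h2]
      rw [← Finset.sum_div, div_le_iff₀ (by norm_num)]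
      norm_num at h1 ⊢
      linarith)
    (by norm_num)
  have hnear : ∀ l, |∑ j, t j * g j l| ≤ (∑ j, |g j l|) * (1 / 10 ^ 9) := by
    intro l
    rw [Finset.sum_mul]
    apply (Finset.abs_sum_le_sum_abs _ _).trans
    apply Finset.sum_le_sum
    intro j _
    rw [abs_mul, mul_comm]
    exact mul_le_mul_of_nonneg_left ((norm_le_pi_norm t j).trans ht) (abs_nonneg _)
  have hnear3 : ∀ l, |∑ j, t j * g j l| ≤ 3 / 10 ^ 9 := by
    intro l
    have h1 := hnear l
    rw [hgsum] at h1
    have := (hcell' l).1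
    linarith
  refine ⟨fun l => w l + ∑ j, t j * g j l, ?_, ?_, heq, ?_⟩
  · intro l
    have h1 := hnear l
    rw [hgsum] at h1
    have h2 := (hcell' l).2.1
    have h3 := (abs_le.1 h1).1
    simp only [hw]
    linarith
  · rw [Finset.sum_add_distrib, Finset.sum_comm]
    have h1 : ∑ l, w l = 1 := by
      have h2 : (∑ l : Fin cells.length, ((cells.get l).weight : ℝ)) = 10 ^ 12 := by
        have : ∑ l : Fin cells.length, (cells.get l).weight = 10 ^ 12 := by
          rw [← hsum, sum_map_eq_sum_get]
        exact_mod_cast this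
      rw [hw, ← Finset.sum_div, h2]
      norm_num
    have h3 : ∀ j, ∑ l, g j l = 0 := by
      intro j
      have h2 : (∑ l : Fin cells.length, ((cells.get l).dir j : ℝ)) = 0 := by
        have : ∑ l : Fin cells.length, (cells.get l).dir j = 0 := by
          rw [← hdir j, sum_map_eq_sum_get]
        exact_mod_cast this
      rw [hg, ← Finset.sum_div, h2, zero_div]
    simp_rw [← Finset.mul_sum, h3, h1]
    simp
  · intro hone
    have h1 : (10 : ℝ) ^ 48 ≤ |(cellForm cells τ : ℝ) - 10 ^ 48| * 20 := by
      exact_mod_cast hτ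
    -- The move changes the form of `τ` by at most `1382976 * 12 / 10 ^ 9 < 1 / 20`, less than its
    -- certified distance from `1`.
    have h2 := abs_quarticForm_sub_le (fun s => (cellCoeff cells τ s : ℝ)) w
      (fun l => w l + ∑ j, t j * g j l) (η := 3 / 10 ^ 9) (sum_abs_cellCoeff_le cells hlen τ)
      (fun l => by
        have := hwr l
        norm_num at this ⊢
        linarith)
      (fun l => by
        have h3 := hwr l
        have h4 := hnear3 l
        refine (abs_add_le _ _).trans ?_
        linarith)
      (fun l => by
        have h4 := hnear3 l
        rwa [sub_add_cancel_left, abs_neg]) (by norm_num)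
    rw [hone, ← cellForm_eq, div_sub_one (by norm_num), abs_div,
        abs_of_pos (show (0 : ℝ) < 10 ^ 48 by norm_num), div_le_iff₀ (by norm_num)] at h2
    norm_num at h1 h2
    linarith

theorem IsCertificate.not_isQuasirandomForcing {cells : List Cell} {ρ : Fin 4 → Fin 4 → Fin 4}
    {τ : Fin 4 → Fin 4} (h : IsCertificate cells ρ τ) (hτ : Function.Bijective τ)
    (inv flipX flipY : Bool) (π : Fin 4 → Equiv.Perm (Fin 4))
    (hπ : ∀ i, ∃ j, ⇑(squareSymmetry inv flipX flipY (π i)).symm = ρ j) :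
    ¬ IsQuasirandomForcing (Set.range fun i => (⟨4, π i⟩ : FinPerm)) := by
  obtain ⟨v, hv, hv1, heq, hne⟩ := h.exists_weights
  obtain ⟨col, row, hsym⟩ := exists_limitDensity_squareSymmetry (k := 4)
    (fun l => ((cells.get l).col : ℤ)) (fun l => ((cells.get l).row : ℤ)) v inv flipX flipY
  have hsurj : Function.Surjective
      (squareSymmetry inv flipX flipY : Equiv.Perm (Fin 4) → Equiv.Perm (Fin 4)) := by
    rw [← Finite.injective_iff_surjective]
    intro a b hab
    simp only [squareSymmetry, mul_left_inj, mul_right_inj] at hab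
    cases inv <;> simpa using hab
  -- The fifth pattern is the one that the symmetry carries to the pattern with inverse `τ`.
  obtain ⟨σ, hσ⟩ := hsurj (Equiv.ofBijective τ hτ).symm
  refine not_isQuasirandomForcing_of_limitDensity col row v hv hv1 _ ?_ ⟨4, σ⟩ ?_
  · rintro _ ⟨i, rfl⟩
    obtain ⟨j, hj⟩ := hπ i
    simp only
    rw [hsym, limitDensity_eq_quarticForm, hj, heq]
    norm_num [Nat.factorial]
  · simp only
    rw [hsym, hσ, limitDensity_eq_quarticForm]
    intro h0
    apply hne
    have h1 : (⇑(Equiv.ofBijective τ hτ).symm.symm : Fin 4 → Fin 4) = τ := rfl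
    rw [h1] at h0
    norm_num [Nat.factorial] at h0
    linarith

/-! ### The ten certificates -/

/-- There is a certificate for the patterns of the representative `m`. -/
def HasCertificate (m : Fin 12) : Prop :=
  ∃ (cells : List Cell) (ρ : Fin 4 → Fin 4 → Fin 4) (τ : Fin 4 → Fin 4),
    IsCertificate cells ρ τ ∧ Function.Bijective τ ∧
    ∀ σ : Equiv.Perm (Fin 4), oneLine σ ∈ latinQuadruple m → ∃ j, ⇑σ.symm = ρ j

theorem hasCertificate_1 : HasCertificate 1 :=
  ⟨[⟨0, 0, 158238863391, ![253, 141, -149, 282]⟩,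
      ⟨0, 2, 249159746660, ![579, -186, -26, 395]⟩,
      ⟨1, 3, 68849037132, ![17, -360, 24, -398]⟩,
      ⟨2, 0, 164384483792, ![-618, -244, -465, -289]⟩,
      ⟨2, 3, 147798383572, ![-146, 122, 199, -240]⟩,
      ⟨3, 1, 211569485453, ![-85, 527, 417, 250]⟩],
    ![![0, 1, 2, 3], ![1, 0, 3, 2], ![3, 2, 0, 1], ![2, 3, 1, 0]],
    ![2, 3, 0, 1], by decide +kernel, by decide +kernel, by decide +kernel⟩

theorem hasCertificate_2 : HasCertificate 2 :=
  ⟨[⟨0, 0, 11446162777, ![-54, -150, -41, -177]⟩,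
      ⟨1, 3, 63830465246, ![-168, -23, -247, -16]⟩,
      ⟨2, 0, 110177414702, ![237, -33, 249, 221]⟩,
      ⟨2, 2, 431522752382, ![-55, 87, -46, -44]⟩,
      ⟨3, 1, 238462686313, ![-16, -83, 230, -106]⟩,
      ⟨3, 3, 144560518580, ![56, 202, -145, 122]⟩],
    ![![0, 1, 2, 3], ![3, 0, 1, 2], ![2, 3, 0, 1], ![1, 2, 3, 0]],
    ![3, 2, 1, 0], by decide +kernel, by decide +kernel, by decide +kernel⟩

theorem hasCertificate_3 : HasCertificate 3 :=
  ⟨[⟨0, 2, 116329811056, ![163, 296, 224, 161]⟩,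
      ⟨1, 0, 188904406311, ![-138, -443, 73, -268]⟩,
      ⟨1, 3, 192744837880, ![-152, 129, -312, -22]⟩,
      ⟨2, 2, 490662846156, ![-212, -260, -220, -206]⟩,
      ⟨3, 1, 4994429629, ![140, 16, 207, 154]⟩,
      ⟨3, 3, 6363668968, ![199, 262, 28, 181]⟩],
    ![![0, 1, 2, 3], ![2, 0, 3, 1], ![1, 3, 0, 2], ![3, 2, 1, 0]],
    ![0, 3, 2, 1], by decide +kernel, by decide +kernel, by decide +kernel⟩

theorem hasCertificate_4 : HasCertificate 4 :=
  ⟨[⟨0, 0, 49569406297, ![-53, -217, -136, -136]⟩,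
      ⟨0, 3, 123550982738, ![-35, -42, -119, 133]⟩,
      ⟨1, 1, 412184241933, ![82, 132, 77, 77]⟩,
      ⟨2, 2, 278061908055, ![176, 170, 118, 118]⟩,
      ⟨3, 0, 123550982738, ![-35, -42, 133, -119]⟩,
      ⟨3, 3, 13082478239, ![-135, -1, -73, -73]⟩],
    ![![0, 1, 3, 2], ![1, 0, 2, 3], ![3, 2, 0, 1], ![2, 3, 1, 0]],
    ![3, 1, 2, 0], by decide +kernel, by decide +kernel, by decide +kernel⟩

theorem hasCertificate_5 : HasCertificate 5 :=
  ⟨[⟨0, 0, 48662195803, ![1, -153, -46, -128]⟩,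
      ⟨1, 3, 28295537923, ![-177, -93, -163, -68]⟩,
      ⟨2, 0, 124478606996, ![196, 140, 39, 235]⟩,
      ⟨2, 2, 390031175309, ![-57, 20, 57, -52]⟩,
      ⟨3, 1, 274692062323, ![115, -37, 205, 62]⟩,
      ⟨3, 3, 133840421646, ![-78, 123, -92, -49]⟩],
    ![![0, 1, 3, 2], ![2, 0, 1, 3], ![3, 2, 0, 1], ![1, 3, 2, 0]],
    ![2, 0, 3, 1], by decide +kernel, by decide +kernel, by decide +kernel⟩

theorem hasCertificate_6 : HasCertificate 6 :=
  ⟨[⟨0, 0, 44211349793, ![188, 48, 125, 80]⟩,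
      ⟨0, 3, 30126810611, ![57, 62, 30, 106]⟩,
      ⟨1, 1, 392078608694, ![-147, -146, -161, -123]⟩,
      ⟨2, 0, 253941473469, ![-127, -219, 8, -118]⟩,
      ⟨2, 2, 260257535184, ![-159, -5, -263, -106]⟩,
      ⟨3, 1, 19384222249, ![188, 260, 261, 161]⟩],
    ![![0, 2, 1, 3], ![1, 0, 3, 2], ![2, 3, 0, 1], ![3, 1, 2, 0]],
    ![3, 0, 1, 2], by decide +kernel, by decide +kernel, by decide +kernel⟩

theorem hasCertificate_8 : HasCertificate 8 :=
  ⟨[⟨0, 0, 31041884081, ![-406, -446, -422, -375]⟩,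
      ⟨0, 2, 167501196010, ![255, 237, 282, 125]⟩,
      ⟨1, 3, 55183826477, ![-580, -206, -640, -391]⟩,
      ⟨2, 0, 23722338935, ![644, 553, 458, 538]⟩,
      ⟨3, 1, 206201395190, ![-469, -785, -58, -139]⟩,
      ⟨3, 2, 372047034894, ![40, 29, 59, 38]⟩,
      ⟨3, 3, 144302324413, ![516, 618, 321, 204]⟩],
    ![![0, 2, 1, 3], ![2, 0, 3, 1], ![3, 1, 0, 2], ![1, 3, 2, 0]],
    ![2, 3, 0, 1], by decide +kernel, by decide +kernel, by decide +kernel⟩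

theorem hasCertificate_9 : HasCertificate 9 :=
  ⟨[⟨0, 0, 80342501223, ![175, 96, 95, 38]⟩,
      ⟨1, 1, 429422339026, ![-130, 122, -47, -56]⟩,
      ⟨2, 0, 289051303270, ![-86, 112, 18, 29]⟩,
      ⟨2, 2, 56277212912, ![-124, -242, -241, -129]⟩,
      ⟨3, 1, 131697244036, ![163, -148, 35, 182]⟩,
      ⟨3, 3, 13209399533, ![2, 60, 140, -64]⟩],
    ![![0, 3, 1, 2], ![3, 0, 2, 1], ![1, 2, 0, 3], ![2, 1, 3, 0]],
    ![1, 3, 2, 0], by decide +kernel, by decide +kernel, by decide +kernel⟩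

theorem hasCertificate_10 : HasCertificate 10 :=
  ⟨[⟨0, 1, 145388796212, ![-2, -49, -113, -61]⟩,
      ⟨0, 3, 58829857487, ![9, 27, 18, 101]⟩,
      ⟨1, 2, 661019128861, ![36, -18, -16, -11]⟩,
      ⟨2, 1, 20957326533, ![163, 67, 130, 65]⟩,
      ⟨3, 0, 35941312515, ![-120, 28, -63, -37]⟩,
      ⟨3, 3, 77863578392, ![-86, -55, 44, -57]⟩],
    ![![0, 3, 1, 2], ![3, 0, 2, 1], ![2, 1, 0, 3], ![1, 2, 3, 0]],
    ![0, 1, 2, 3], by decide +kernel, by decide +kernel, by decide +kernel⟩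

theorem hasCertificate_11 : HasCertificate 11 :=
  ⟨[⟨0, 3, 27812876466, ![-32, 24, -11, 48]⟩,
      ⟨1, 0, 304456245716, ![6, -63, -196, -21]⟩,
      ⟨1, 2, 39461354153, ![103, -31, 181, 5]⟩,
      ⟨2, 1, 413267620573, ![82, -57, -173, -7]⟩,
      ⟨3, 0, 78573758593, ![14, 112, 54, 19]⟩,
      ⟨3, 3, 136428144499, ![-173, 15, 145, -44]⟩],
    ![![0, 3, 2, 1], ![3, 0, 1, 2], ![2, 1, 0, 3], ![1, 2, 3, 0]],
    ![0, 1, 2, 3], by decide +kernel, by decide +kernel, by decide +kernel⟩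

theorem hasCertificate (m : Fin 12) (h0 : m ≠ 0) (h7 : m ≠ 7) : HasCertificate m := by
  fin_cases m
  · exact absurd rfl h0
  · exact hasCertificate_1
  · exact hasCertificate_2
  · exact hasCertificate_3
  · exact hasCertificate_4
  · exact hasCertificate_5
  · exact hasCertificate_6
  · exact absurd rfl h7
  · exact hasCertificate_8
  · exact hasCertificate_9
  · exact hasCertificate_10
  · exact hasCertificate_11

/-! ### Classification of the quadruples -/

/-- Every cell of the grid lies on exactly one of the permutations `π t`. -/
def IsLatin (π : Fin 4 → Equiv.Perm (Fin 4)) : Prop :=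
  ∀ a b, ∃! t, π t a = b

theorem sum_permMatrix_eq_iff_isLatin (π : Fin 4 → Equiv.Perm (Fin 4)) :
    ∑ i, (π i).permMatrix ℝ = Matrix.of (fun _ _ => (1 : ℝ)) ↔ IsLatin π := by
  rw [← Matrix.ext_iff]
  refine forall_congr' fun a => forall_congr' fun b => ?_
  have h : (∑ i, (π i).permMatrix ℝ) a b =
      ((Finset.univ.filter fun t => π t a = b).card : ℝ) := by
    rw [Matrix.sum_apply, Finset.card_filter]
    push_cast
    apply Finset.sum_congr rfl
    intro t _
    simp [Equiv.Perm.permMatrix, PEquiv.toMatrix_apply, Equiv.toPEquiv_apply, eq_comm]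
  rw [h, Matrix.of_apply, Nat.cast_eq_one, Finset.card_eq_one]
  simp [ExistsUnique, Finset.eq_singleton_iff_unique_mem]

theorem IsLatin.of_rev_mul {π : Fin 4 → Equiv.Perm (Fin 4)}
    (h : IsLatin fun i => Fin.revPerm * π i) : IsLatin π := by
  intro a b
  simpa using h a (Fin.rev b)

theorem IsLatin.of_mul_rev {π : Fin 4 → Equiv.Perm (Fin 4)}
    (h : IsLatin fun i => π i * Fin.revPerm) : IsLatin π := by
  intro a b
  simpa using h (Fin.rev a) b

theorem IsLatin.of_inv {π : Fin 4 → Equiv.Perm (Fin 4)}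
    (h : IsLatin fun i => (π i)⁻¹) : IsLatin π := by
  intro a b
  have := h b a
  simp only [Equiv.Perm.inv_eq_iff_eq] at this
  simpa only [eq_comm] using this

theorem IsLatin.of_squareSymmetry {inv flipX flipY : Bool} {π : Fin 4 → Equiv.Perm (Fin 4)}
    (h : IsLatin fun i => squareSymmetry inv flipX flipY (π i)) : IsLatin π := by
  have h1 : IsLatin fun i => (if flipY then Fin.revPerm else 1) * (if inv then (π i)⁻¹ else π i) := by
    cases flipX
    · simpa [squareSymmetry] using h
    · exact IsLatin.of_mul_rev h
  have h2 : IsLatin fun i => if inv then (π i)⁻¹ else π i := by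
    cases flipY
    · simpa using h1
    · exact IsLatin.of_rev_mul h1
  cases inv
  · exact h2
  · exact IsLatin.of_inv h2

theorem latinQuadruple_card (m : Fin 12) : (latinQuadruple m).card = 4 := by
  revert m; decide +kernel

theorem latinQuadruple_existsUnique (m : Fin 12) (a b : Fin 4) :
    ∃ w ∈ latinQuadruple m, w a = b + 1 ∧ ∀ w' ∈ latinQuadruple m, w' a = b + 1 → w' = w := by
  revert m a b; decide +kernel

theorem oneLine_apply_eq_iff (σ : Equiv.Perm (Fin 4)) (a b : Fin 4) :
    oneLine σ a = b + 1 ↔ σ a = b := by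
  simp [oneLine, Fin.ext_iff]

/-- Since the representative has four distinct words, the members of `π` are distinct, and the
unique word through a cell comes from a unique index. -/
theorem isLatin_of_wordSet_eq {π : Fin 4 → Equiv.Perm (Fin 4)} {m : Fin 12}
    (h : wordSet π = latinQuadruple m) : IsLatin π := by
  have hinj : Function.Injective fun i => oneLine (π i) := by
    rw [← Set.injOn_univ, ← Finset.coe_univ, ← Finset.card_image_iff]
    have := latinQuadruple_card m
    rw [← h] at this
    exact this
  intro a b
  obtain ⟨w, hw, hab, huniq⟩ := latinQuadruple_existsUnique m a b
  rw [← h] at hw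
  obtain ⟨t, -, ht⟩ := Finset.mem_image.1 hw
  refine ⟨t, ?_, ?_⟩
  · rw [← ht] at hab
    exact (oneLine_apply_eq_iff _ _ _).1 hab
  · intro u hu
    apply hinj
    simp only
    rw [ht]
    apply huniq _ _ ((oneLine_apply_eq_iff _ _ _).2 hu)
    rw [← h]
    exact Finset.mem_image_of_mem _ (Finset.mem_univ u)

theorem wordSet_comp_equiv (π : Fin 4 → Equiv.Perm (Fin 4)) (e : Equiv.Perm (Fin 4)) :
    wordSet (fun i => π (e i)) = wordSet π := by
  ext w
  simp only [wordSet, Finset.mem_image, Finset.mem_univ, true_and]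
  exact e.exists_congr_left.trans (by simp)

/-- Two permutations of `Fin 4` share no cell. -/
def SharesNoCell (σ τ : Equiv.Perm (Fin 4)) : Prop := ∀ a, σ a ≠ τ a

instance (σ τ : Equiv.Perm (Fin 4)) : Decidable (SharesNoCell σ τ) := by
  unfold SharesNoCell; infer_instance

/-- Some rotation or reflection carries the quadruple `π` to the representative `m`. -/
def IsRepresentedBy (π : Fin 4 → Equiv.Perm (Fin 4)) (m : Fin 12) : Prop :=
  ∃ inv flipX flipY : Bool,
    wordSet (fun i => squareSymmetry inv flipX flipY (π i)) = latinQuadruple m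

instance (π : Fin 4 → Equiv.Perm (Fin 4)) (m : Fin 12) : Decidable (IsRepresentedBy π m) := by
  unfold IsRepresentedBy; infer_instance

/-- Fixing the first values removes the ordering of the quadruple. Each disjointness condition
stands as early as possible, so that the search is pruned; 24 quadruples survive, as many as Latin
squares of order 4 with prescribed first row. -/
theorem exists_isRepresentedBy_of_sharesNoCell :
    ∀ a : Equiv.Perm (Fin 4), a 0 = 0 → ∀ b : Equiv.Perm (Fin 4), b 0 = 1 → SharesNoCell a b →
    ∀ c : Equiv.Perm (Fin 4), c 0 = 2 → SharesNoCell a c → SharesNoCell b c →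
    ∀ d : Equiv.Perm (Fin 4), d 0 = 3 → SharesNoCell a d → SharesNoCell b d → SharesNoCell c d →
    ∃ m : Fin 12, IsRepresentedBy ![a, b, c, d] m ∧
      ∀ m' : Fin 12, IsRepresentedBy ![a, b, c, d] m' → m' = m := by
  decide +kernel

theorem IsLatin.injective_apply {π : Fin 4 → Equiv.Perm (Fin 4)} (h : IsLatin π) (a : Fin 4) :
    Function.Injective fun t => π t a := by
  intro s t hst
  exact (h a (π t a)).unique hst rfl

theorem IsLatin.injective {π : Fin 4 → Equiv.Perm (Fin 4)} (h : IsLatin π) :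
    Function.Injective π := fun s t hst =>
  h.injective_apply 0 (by simp only [hst])

theorem isRepresentedBy_comp_equiv (π : Fin 4 → Equiv.Perm (Fin 4)) (e : Equiv.Perm (Fin 4))
    (m : Fin 12) : IsRepresentedBy (fun i => π (e i)) m ↔ IsRepresentedBy π m := by
  unfold IsRepresentedBy
  have h := fun inv flipX flipY =>
    wordSet_comp_equiv (fun i => squareSymmetry inv flipX flipY (π i)) e
  simp only [h]

theorem IsLatin.existsUnique_isRepresentedBy {π : Fin 4 → Equiv.Perm (Fin 4)} (h : IsLatin π) :
    ∃! m : Fin 12, IsRepresentedBy π m := by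
  -- The first values of the four permutations are distinct, so they serve as the new index.
  set e : Equiv.Perm (Fin 4) :=
    Equiv.ofBijective _ (Finite.injective_iff_bijective.1 (h.injective_apply 0)) with he
  have h0 : ∀ t, π (e.symm t) 0 = t := fun t => e.apply_symm_apply t
  have hne : ∀ s t, s ≠ t → SharesNoCell (π (e.symm s)) (π (e.symm t)) := by
    intro s t hst a hab
    exact hst (e.symm.injective (h.injective_apply a hab))
  obtain ⟨m, hm, huniq⟩ := exists_isRepresentedBy_of_sharesNoCell
    _ (h0 0) _ (h0 1) (hne 0 1 (by decide)) _ (h0 2) (hne 0 2 (by decide)) (hne 1 2 (by decide))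
    _ (h0 3) (hne 0 3 (by decide)) (hne 1 3 (by decide)) (hne 2 3 (by decide))
  have hvec : ![π (e.symm 0), π (e.symm 1), π (e.symm 2), π (e.symm 3)] =
      fun i => π (e.symm i) := by
    funext i
    fin_cases i <;> rfl
  simp only [hvec, isRepresentedBy_comp_equiv] at hm huniq
  exact ⟨m, hm, huniq⟩

/-- The two exceptional quadruples are fixed by every symmetry, so excluding these two sets excludes
their whole orbits. -/
theorem oneLine_mem_of_squareSymmetry_mem (m : Fin 12) (hm : m = 0 ∨ m = 7)
    (inv flipX flipY : Bool) (σ : Equiv.Perm (Fin 4))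
    (h : oneLine (squareSymmetry inv flipX flipY σ) ∈ latinQuadruple m) :
    oneLine σ ∈ latinQuadruple m := by
  rcases hm with rfl | rfl <;> revert inv flipX flipY σ <;> decide +kernel

theorem IsLatin.wordSet_eq_of_isRepresentedBy {π : Fin 4 → Equiv.Perm (Fin 4)} (h : IsLatin π)
    {m : Fin 12} (hm : m = 0 ∨ m = 7) (hπ : IsRepresentedBy π m) :
    wordSet π = latinQuadruple m := by
  obtain ⟨inv, flipX, flipY, hw⟩ := hπ
  apply Finset.eq_of_subset_of_card_le
  · intro w hwπ
    obtain ⟨i, -, rfl⟩ := Finset.mem_image.1 hwπ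
    apply oneLine_mem_of_squareSymmetry_mem m hm inv flipX flipY
    rw [← hw]
    exact Finset.mem_image_of_mem _ (Finset.mem_univ i)
  · rw [latinQuadruple_card, wordSet, Finset.card_image_of_injective]
    · simp
    · intro s t hst
      apply h.injective
      ext a
      have := congrFun hst a
      simpa [oneLine] using this

theorem mainTheorem5 :
    (∀ π : Fin 4 → Equiv.Perm (Fin 4),
      ∑ i, (π i).permMatrix ℝ = Matrix.of (fun _ _ => (1 : ℝ)) →
      wordSet π ≠ {![1, 2, 3, 4], ![2, 1, 4, 3], ![3, 4, 1, 2], ![4, 3, 2, 1]} →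
      wordSet π ≠ {![1, 3, 2, 4], ![2, 4, 1, 3], ![3, 1, 4, 2], ![4, 2, 3, 1]} →
      ¬ IsQuasirandomForcing (Set.range fun i => (⟨4, π i⟩ : FinPerm))) ∧
    (∀ π : Fin 4 → Equiv.Perm (Fin 4),
      ∑ i, (π i).permMatrix ℝ = Matrix.of (fun _ _ => (1 : ℝ)) ↔
        ∃! m : Fin 12, ∃ inv flipX flipY : Bool,
          wordSet (fun i => squareSymmetry inv flipX flipY (π i)) = latinQuadruple m) := by
  refine ⟨fun π hπ hne0 hne7 => ?_, fun π => ?_⟩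
  · have hlatin := (sum_permMatrix_eq_iff_isLatin π).1 hπ
    obtain ⟨m, hm, -⟩ := hlatin.existsUnique_isRepresentedBy
    have h0 : m ≠ 0 := by
      rintro rfl
      exact hne0 (hlatin.wordSet_eq_of_isRepresentedBy (Or.inl rfl) hm)
    have h7 : m ≠ 7 := by
      rintro rfl
      exact hne7 (hlatin.wordSet_eq_of_isRepresentedBy (Or.inr rfl) hm)
    obtain ⟨cells, ρ, τ, hcert, hτ, hmem⟩ := hasCertificate m h0 h7
    obtain ⟨inv, flipX, flipY, hw⟩ := hm
    refine hcert.not_isQuasirandomForcing hτ inv flipX flipY π fun i => hmem _ ?_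
    rw [← hw]
    exact Finset.mem_image_of_mem _ (Finset.mem_univ i)
  · rw [sum_permMatrix_eq_iff_isLatin]
    constructor
    · exact fun h => h.existsUnique_isRepresentedBy
    · rintro ⟨m, ⟨inv, flipX, flipY, hw⟩, -⟩
      exact (isLatin_of_wordSet_eq hw).of_squareSymmetry
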